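/- Let $T=(S^1)^n$ act componentwise on $\mathbb{C}^n$, let $\omega=\sqrt{-1}\,\partial\bar\partial\sum_i|z_i|^2=\sqrt{-1}\sum_i dz_i\wedge d\bar z_i$ be the standard Kähler form, and let $\Phi(z)=(|z_1|^2,\dots,|z_n|^2)$ be the $T$-moment map. Let $G\subset T$ be a subtorus with Lie algebra $\mathfrak g\subset\mathbb{R}^n$, let $\alpha_i\in\mathfrak g^*$, $\alpha_i(\xi)=\xi_i$, be its weights, and let $\psi(z)=\sum_i|z_i|^2\alpha_i$ be the $G$-moment map. Assume that the weights are polarized, i.e. there is $\xi\in\mathfrak g$ with $\alpha_i(\xi)>0$ for all $i$. Let $\lambda\in\mathfrak g^*$ be a regular value of $\psi$ such that $G$ acts freely on $\psi^{-1}(\lambda)$, let $M_\lambda=\psi^{-1}(\lambda)/G$, let $p:\psi^{-1}(\lambda)\to M_\lambda$ be the projection, and let $\Phi_\lambda:M_\lambda\to\mathbb{R}^n$ be the map with $\Phi_\lambda\circ p=\Phi|_{\psi^{-1}(\lambda)}$. Let $\Delta_\lambda=\Phi_\lambda(M_\lambda)$ be the moment polytope, let $\ell_i$ be the restriction to $\Delta_\lambda$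 of the $i$-th coordinate function $t_i$ of $\mathbb{R}^n$ (the distance to the hyperplane $t_i=0$, which cuts out the $i$-th facet), and fix $c=(c_1,\dots,c_n)\in\Delta_\lambda$. Then the quotient space $M_\lambda$ carries a reduced complex structure of complex dimension $n-\dim G$, that is, a structure of complex manifold for which $p$ is a smooth submersion whose differential is complex linear on the horizontal spaces (the largest complex subspaces of the tangent spaces of $\psi^{-1}(\lambda)$, which are the orthogonal complements of the orbit directions). For any such structure there is a unique 2-form $\omega_\lambda$ on $M_\lambda$ with $p^*\omega_\lambda=\omega|_{\psi^{-1}(\lambda)}$. Moreover, the subset $U=\bigl((\mathbb{C}^*)^n\cap\psi^{-1}(\lambda)\bigr)/G$ of $M_\lambda$ is open and dense, the function $$\rho_\lambda=\Phi_\lambda^*\Bigl(\sum_{i=1}^n\bigl(\ell_i-c_i\operatorname{Log}\ell_i\bigr)\Bigr)$$ is smooth on $U$, and $$\omega_\lambda|_U=\sqrt{-1}\,\partial\bar\partial\rho_\lambda .$$ -/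

import Mathlib

open scoped Manifold ContDiff Topology

noncomputable section

namespace ToricReduction

/-! ### Subtori of the standard torus `T = (S¹)ⁿ`, acting componentwise on `ℂⁿ` -/

/-- A subtorus of `T = (S¹)ⁿ`: a subgroup which is itself a torus, that is, the image of an
injective continuous homomorphism `(S¹)ᵏ → (S¹)ⁿ` for some `k`. -/
def IsSubtorus {n : ℕ} (G : Subgroup (Fin n → Circle)) : Prop :=
  ∃ (k : ℕ) (φ : (Fin k → Circle) →* (Fin n → Circle)),
    Continuous φ ∧ Function.Injective φ ∧ φ.range = G

/-- The Lie algebra `𝔤 ⊆ ℝⁿ` of `G ⊆ T`: all `ξ` whose one-parameter group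
`t ↦ (e^{i t ξ₁}, …, e^{i t ξₙ})` stays in `G`. -/
def lieAlg {n : ℕ} (G : Subgroup (Fin n → Circle)) : Submodule ℝ (Fin n → ℝ) where
  carrier := {ξ | ∀ t : ℝ, (fun j => Circle.exp (t * ξ j)) ∈ G}
  zero_mem' := by
    intro t
    have : (fun j : Fin n => Circle.exp (t * (0 : Fin n → ℝ) j)) = 1 := by
      ext j; simp
    rw [this]; exact G.one_mem
  add_mem' := by
    intro a b ha hb t
    have : (fun j => Circle.exp (t * (a + b) j))
        = (fun j => Circle.exp (t * a j)) * (fun j => Circle.exp (t * b j)) := by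
      funext j; simp [mul_add, Circle.exp_add]
    rw [this]; exact G.mul_mem (ha t) (hb t)
  smul_mem' := by
    intro r a ha t
    have : (fun j => Circle.exp (t * (r • a) j)) = (fun j => Circle.exp ((t * r) * a j)) := by
      funext j; simp [mul_assoc]
    exact this ▸ ha (t * r)

/-- The weight `αᵢ ∈ 𝔤*` of `G` on the `i`-th coordinate line of `ℂⁿ`: the image of `eᵢ` under the
transpose `ℝⁿ → 𝔤*` of the inclusion `𝔤 ⊆ ℝⁿ`, i.e. `αᵢ(ξ) = ξᵢ`. -/
def weight {n : ℕ} (G : Subgroup (Fin n → Circle)) (i : Fin n) : lieAlg G →L[ℝ] ℝ :=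
  (ContinuousLinearMap.proj i : (Fin n → ℝ) →L[ℝ] ℝ).comp (lieAlg G).subtypeL

/-- The weights are polarized: some `ξ ∈ 𝔤` has `αᵢ(ξ) > 0` for all `i`. -/
def Polarized {n : ℕ} (G : Subgroup (Fin n → Circle)) : Prop :=
  ∃ ξ : lieAlg G, ∀ i, 0 < weight G i ξ

/-! ### The standard Kähler form and the moment maps on `ℂⁿ` -/

/-- The standard form `i ∂∂̄ ∑ |zⱼ|² = i ∑ dzⱼ ∧ dz̄ⱼ = 2 ∑ dxⱼ ∧ dyⱼ` on `ℂⁿ`, evaluated on `v, w`. -/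
def stdForm {n : ℕ} (v w : Fin n → ℂ) : ℝ :=
  2 * ∑ j, (starRingEnd ℂ (v j) * w j).im

/-- The moment map `Φ(z) = (|z₁|², …, |zₙ|²)` of `T` on `ℂⁿ`. -/
def torusMoment {n : ℕ} (z : Fin n → ℂ) : Fin n → ℝ := fun i => ‖z i‖ ^ 2

/-- The moment map `ψ(z) = ∑ |zᵢ|² αᵢ` of `G` on `ℂⁿ`. -/
def moment {n : ℕ} (G : Subgroup (Fin n → Circle)) (z : Fin n → ℂ) : lieAlg G →L[ℝ] ℝ :=
  ∑ i, torusMoment z i • weight G i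

/-- The level set `ψ⁻¹(lam)`. -/
def level {n : ℕ} (G : Subgroup (Fin n → Circle)) (lam : lieAlg G →L[ℝ] ℝ) : Set (Fin n → ℂ) :=
  {z | moment G z = lam}

/-- `lam` is a regular value of `ψ`. -/
def IsRegularValue {n : ℕ} (G : Subgroup (Fin n → Circle)) (lam : lieAlg G →L[ℝ] ℝ) : Prop :=
  ∀ z ∈ level G lam, Function.Surjective (fderiv ℝ (moment G) z)

/-- `G` acts freely on `ψ⁻¹(lam)`. -/
def ActsFreely {n : ℕ} (G : Subgroup (Fin n → Circle)) (lam : lieAlg G →L[ℝ] ℝ) : Prop :=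
  ∀ z ∈ level G lam, ∀ g ∈ G, g • z = z → g = 1

/-- The tangent space `T_z ψ⁻¹(ψ(z)) = ker dψ_z` of the level set through `z`. -/
def levelTangent {n : ℕ} (G : Subgroup (Fin n → Circle)) (z : Fin n → ℂ) :
    Set (Fin n → ℂ) :=
  {v | fderiv ℝ (moment G) z v = 0}

/-- The horizontal space at `z`: the largest complex subspace of the tangent space of the level
set. As `dψ_z(i v) = 0` says that `v` is orthogonal to the orbit direction `𝔤·z`, it is the
orthogonal complement of the tangent space of the `G`-orbit inside that of the level set. -/
def horizontal {n : ℕ} (G : Subgroup (Fin n → Circle)) (z : Fin n → ℂ) : Set (Fin n → ℂ) :=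
  {v | v ∈ levelTangent G z ∧ Complex.I • v ∈ levelTangent G z}

/-! ### The reduced space `M = ψ⁻¹(lam)/G` -/

/-- Points of the level set are equivalent when they lie on the same `G`-orbit. -/
def orbitSetoid {n : ℕ} (G : Subgroup (Fin n → Circle)) (lam : lieAlg G →L[ℝ] ℝ) :
    Setoid (level G lam) :=
  (MulAction.orbitRel G (Fin n → ℂ)).comap Subtype.val

/-- The reduced space `ψ⁻¹(lam)/G`, with the quotient topology. -/
abbrev ReducedSpace {n : ℕ} (G : Subgroup (Fin n → Circle)) (lam : lieAlg G →L[ℝ] ℝ) : Type :=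
  Quotient (orbitSetoid G lam)

/-- The projection `p : ψ⁻¹(lam) → ψ⁻¹(lam)/G`. -/
def proj {n : ℕ} (G : Subgroup (Fin n → Circle)) (lam : lieAlg G →L[ℝ] ℝ) :
    level G lam → ReducedSpace G lam :=
  Quotient.mk (orbitSetoid G lam)

/-- The model space `ℂᵈ` of the reduced space, with `d = n - dim G`. -/
abbrev Model {n : ℕ} (G : Subgroup (Fin n → Circle)) : Type :=
  Fin (n - Module.finrank ℝ (lieAlg G)) → ℂ

/-- `P : ℂⁿ → M` is a smooth local extension, near the point `z` of the level set, of the projection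
`p`. For such `P`, the differential `dp_z` is the restriction of `dP_z` to the tangent space of the
level set. -/
def IsLocalExtension {n : ℕ} (G : Subgroup (Fin n → Circle)) (lam : lieAlg G →L[ℝ] ℝ)
    [ChartedSpace (Model G) (ReducedSpace G lam)] (z : level G lam)
    (P : (Fin n → ℂ) → ReducedSpace G lam) : Prop :=
  ContMDiffAt 𝓘(ℝ, Fin n → ℂ) 𝓘(ℝ, Model G) ∞ P (z : Fin n → ℂ) ∧
    ∀ᶠ y : level G lam in 𝓝 z, P (y : Fin n → ℂ) = proj G lam y

/-- The differential of a map `P : ℂⁿ → M` at `z`. Its values lie in the tangent space of `M` at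
`P z`, which is a copy of the model space `ℂᵈ`. -/
def differential {n : ℕ} {G : Subgroup (Fin n → Circle)} {lam : lieAlg G →L[ℝ] ℝ}
    [ChartedSpace (Model G) (ReducedSpace G lam)]
    (P : (Fin n → ℂ) → ReducedSpace G lam) (z : Fin n → ℂ) :
    (Fin n → ℂ) →L[ℝ] Model G :=
  mfderiv 𝓘(ℝ, Fin n → ℂ) 𝓘(ℝ, Model G) P z

/-- The atlas `cs` is the reduced complex structure of `M = ψ⁻¹(lam)/G`: it makes `M` a complex
manifold such that the projection `p` from the level set is a smooth submersion whose differential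
is complex linear on the horizontal spaces. (This determines the complex structure.) -/
structure IsReducedComplexStructure {n : ℕ} (G : Subgroup (Fin n → Circle))
    (lam : lieAlg G →L[ℝ] ℝ) [cs : ChartedSpace (Model G) (ReducedSpace G lam)] : Prop where
  isManifold : IsManifold 𝓘(ℂ, Model G) ω (ReducedSpace G lam)
  smooth : ∀ z : level G lam, ∃ P, IsLocalExtension G lam z P
  submersion : ∀ (z : level G lam) (P), IsLocalExtension G lam z P →
    ∀ u, ∃ v ∈ levelTangent G (z : Fin n → ℂ), differential P z v = u
  complexLinear : ∀ (z : level G lam) (P), IsLocalExtension G lam z P →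
    ∀ v ∈ horizontal G (z : Fin n → ℂ),
      differential P z (Complex.I • v) = Complex.I • differential P z v

/-- Fields of real 2-forms on `M`. -/
abbrev TwoForm {n : ℕ} (G : Subgroup (Fin n → Circle)) (lam : lieAlg G →L[ℝ] ℝ)
    [ChartedSpace (Model G) (ReducedSpace G lam)] : Type :=
  ∀ x : ReducedSpace G lam, (TangentSpace 𝓘(ℝ, Model G) x) [⋀^Fin 2]→L[ℝ] ℝ

/-- `σ` is the reduced form on `M`: its pull-back by `p` to the level set is the restriction of
the standard form of `ℂⁿ`. -/
def IsReducedForm {n : ℕ} {G : Subgroup (Fin n → Circle)} {lam : lieAlg G →L[ℝ] ℝ}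
    [ChartedSpace (Model G) (ReducedSpace G lam)] (σ : TwoForm G lam) : Prop :=
  ∀ (z : level G lam) (P), IsLocalExtension G lam z P →
    ∀ v ∈ levelTangent G (z : Fin n → ℂ), ∀ w ∈ levelTangent G (z : Fin n → ℂ),
      σ (P z) ![differential P z v, differential P z w] = stdForm v w

/-! ### The moment polytope and the potential -/

/-- The moment map of `T` on `M`, determined by `Φ_lam ∘ p = Φ` on the level set. -/
def reducedMoment {n : ℕ} (G : Subgroup (Fin n → Circle)) (lam : lieAlg G →L[ℝ] ℝ) :
    ReducedSpace G lam → Fin n → ℝ :=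
  Quotient.lift (fun z : level G lam => torusMoment (z : Fin n → ℂ)) (by
    rintro a b ⟨g, hg⟩
    funext i
    have h : (a : Fin n → ℂ) i = ((g : Fin n → Circle) i) • (b : Fin n → ℂ) i :=
      (congrFun hg i).symm
    simp only [torusMoment, h, Circle.smul_def, norm_smul, Circle.norm_coe, one_mul])

/-- The moment polytope: the image of `M` under its moment map. -/
def momentPolytope {n : ℕ} (G : Subgroup (Fin n → Circle)) (lam : lieAlg G →L[ℝ] ℝ) :
    Set (Fin n → ℝ) :=
  Set.range (reducedMoment G lam)

/-- `ℓᵢ`, the restriction to the moment polytope of the `i`-th coordinate of `ℝⁿ`: the distance to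
the hyperplane `tᵢ = 0`, which cuts out the `i`-th facet. -/
def facetDist {n : ℕ} (G : Subgroup (Fin n → Circle)) (lam : lieAlg G →L[ℝ] ℝ) (i : Fin n)
    (t : momentPolytope G lam) : ℝ :=
  (t : Fin n → ℝ) i

/-- The potential: the pull-back by the moment map of `∑ᵢ (ℓᵢ - cᵢ log ℓᵢ)`. -/
def potential {n : ℕ} (G : Subgroup (Fin n → Circle)) (lam : lieAlg G →L[ℝ] ℝ)
    (c : Fin n → ℝ) (x : ReducedSpace G lam) : ℝ :=
  ∑ i, (facetDist G lam i ⟨reducedMoment G lam x, Set.mem_range_self x⟩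
    - c i * Real.log (facetDist G lam i ⟨reducedMoment G lam x, Set.mem_range_self x⟩))

/-- The subset `U = ((ℂ*)ⁿ ∩ ψ⁻¹(lam))/G` of `M`. -/
def openPart {n : ℕ} (G : Subgroup (Fin n → Circle)) (lam : lieAlg G →L[ℝ] ℝ) :
    Set (ReducedSpace G lam) :=
  proj G lam '' {z | ∀ i, (z : Fin n → ℂ) i ≠ 0}

/-! ### The operator `i ∂∂̄` -/

/-- `∂̄f`, the complex antilinear part of `df`, as a complex valued 1-form on `ℂᵈ`:
`∂̄f(v) = (df(v) + i df(i v)) / 2`. -/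
def dbar {d : ℕ} (f : (Fin d → ℂ) → ℂ) (y : Fin d → ℂ) : (Fin d → ℂ) [⋀^Fin 1]→L[ℝ] ℂ :=
  ContinuousAlternatingMap.ofSubsingleton ℝ (Fin d → ℂ) ℂ (0 : Fin 1)
    ((1 / 2 : ℂ) • (fderiv ℝ f y + Complex.I •
      (fderiv ℝ f y).comp ((Complex.I • ContinuousLinearMap.id ℂ (Fin d → ℂ)).restrictScalars ℝ)))

/-- `i ∂∂̄f = i d(∂̄f)` as a complex valued 2-form on `ℂᵈ`; the second form is valid since
`d = ∂ + ∂̄` and `∂̄∂̄ = 0`. -/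
def iddbar {d : ℕ} (f : (Fin d → ℂ) → ℂ) (y : Fin d → ℂ) : (Fin d → ℂ) [⋀^Fin 2]→L[ℝ] ℂ :=
  Complex.I • extDeriv (dbar f) y

/-- `i ∂∂̄f` at the point `x` of the complex manifold `M`, for real valued `f`, on tangent vectors
at `x`. It is computed in the chart of `M` at `x`, through which the tangent space at `x` is
identified with `ℂᵈ`. -/
def manifoldIddbar {n : ℕ} {G : Subgroup (Fin n → Circle)} {lam : lieAlg G →L[ℝ] ℝ}
    [ChartedSpace (Model G) (ReducedSpace G lam)] (f : ReducedSpace G lam → ℝ)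
    (x : ReducedSpace G lam) (u v : TangentSpace 𝓘(ℝ, Model G) x) : ℂ :=
  iddbar (fun y : Model G => ((f ((chartAt (Model G) x).symm y) : ℝ) : ℂ))
    (chartAt (Model G) x x) ![u, v]

end ToricReduction

end

noncomputable section

namespace ToricReduction

variable {n : ℕ} {G : Subgroup (Fin n → Circle)} {lam : lieAlg G →L[ℝ] ℝ}

/-! ### The moment map -/

/-! The reduced space is covered by toric charts at vertices of the moment polytope, and in such a
chart the potential is the critical value of a strictly convex function, corrected by pluriharmonic
logarithms.

At a vertex (`exists_vertex`), regularity and extremality make 𝔤 project isomorphically onto the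
coordinates that do not vanish there, and freeness makes the inverse integral: `G` is the graph of a
homomorphism of tori with exponent matrix `a`. The monomials w_j = z_j ∏ z_i^(-a_ij) (`coord`) are
invariant under the complexified group. Conversely, the real exponential of b moves the point (1, w)
into the level set exactly when `eqn w b = 0`. As a function of b, `eqn` is half the gradient of the
strictly convex function ∑ e^(2 b_i) + ∑ e^(2 mon b_j) |w_j|² - 2 ∑ l_i b_i. So its zero `sol w` is
unique, depends smoothly on w, and yields a local section `lift` of the projection. Changes of
charts are Laurent monomials (`contDiffOn_transition`), which gives the complex structure.

Since c satisfies the affine equations of the polytope, the potential in a chart is that convex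
function at its critical point minus ∑ c_j log |w_j|² (`potential_param`). The variation of `sol`
therefore drops out of the first derivative (`fderiv_toricPotential`), the logarithms drop out of
the Levi form, and the standard form on lifted vectors remains (`leviForm_toricPotential`). This is
the reduced form because orbit directions are in the kernel of the standard form on the level set
(`stdForm_eq_stdForm_dlift`).

For an arbitrary reduced complex structure, `param` is a local biholomorphism (`dparam_I_smul`,
`dparam_surjective`), and the Levi form is invariant under holomorphic maps (`leviForm_comp`).
Taking c to be the vertex itself removes the logarithms on its whole chart, which produces the
reduced form also outside `U` (`exists_isReducedForm`). -/

theorem moment_apply (z : Fin n → ℂ) (ξ : lieAlg G) :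
    moment G z ξ = ∑ l, ‖z l‖ ^ 2 * (ξ : Fin n → ℝ) l := by
  simp [moment, torusMoment, weight]

theorem mem_level_iff {z : Fin n → ℂ} :
    z ∈ level G lam ↔ ∀ ξ : lieAlg G, ∑ l, ‖z l‖ ^ 2 * (ξ : Fin n → ℝ) l = lam ξ := by
  simp only [level, Set.mem_ofPred_eq, ContinuousLinearMap.ext_iff, moment_apply]

theorem hasFDerivAt_norm_sq_coord (z : Fin n → ℂ) (l : Fin n) :
    HasFDerivAt (fun y : Fin n → ℂ => ‖y l‖ ^ 2)
      ((2 : ℝ) • (innerSL ℝ (z l)).comp (ContinuousLinearMap.proj l)) z := by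
  have h := (hasStrictFDerivAt_norm_sq (z l)).hasFDerivAt.comp z
    (ContinuousLinearMap.proj (R := ℝ) (φ := fun _ : Fin n => ℂ) l).hasFDerivAt
  refine h.congr_fderiv ?_
  ext v
  simp
  ring

theorem hasFDerivAt_moment (z : Fin n → ℂ) :
    HasFDerivAt (moment G)
      (∑ l, (ContinuousLinearMap.toSpanSingleton ℝ (weight G l)).comp
        ((2 : ℝ) • (innerSL ℝ (z l)).comp (ContinuousLinearMap.proj l) :
          (Fin n → ℂ) →L[ℝ] ℝ)) z := by
  unfold moment torusMoment
  refine HasFDerivAt.fun_sum (𝕜 := ℝ) (E := Fin n → ℂ) (F := lieAlg G →L[ℝ] ℝ) fun l _ => ?_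
  exact HasFDerivAt.comp (𝕜 := ℝ) (E := Fin n → ℂ) (F := ℝ) (G := lieAlg G →L[ℝ] ℝ) z
    (ContinuousLinearMap.hasFDerivAt (𝕜 := ℝ) (E := ℝ) (F := lieAlg G →L[ℝ] ℝ)
      (ContinuousLinearMap.toSpanSingleton ℝ (weight G l)))
    (hasFDerivAt_norm_sq_coord z l)

theorem inner_eq_re_conj_mul (a b : ℂ) : inner ℝ a b = ((starRingEnd ℂ) a * b).re := by
  rw [Complex.inner, mul_comm]

theorem fderiv_moment_apply (z v : Fin n → ℂ) (ξ : lieAlg G) :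
    fderiv ℝ (moment G) z v ξ =
      2 * ∑ l, ((starRingEnd ℂ) (z l) * v l).re * (ξ : Fin n → ℝ) l := by
  rw [(hasFDerivAt_moment z).fderiv, _root_.sum_apply,
    _root_.sum_apply, Finset.mul_sum]
  refine Finset.sum_congr rfl fun l _ => ?_
  have := inner_eq_re_conj_mul (z l) (v l)
  simp only [ContinuousLinearMap.toSpanSingleton_apply, _root_.smul_apply,
    ContinuousLinearMap.comp_apply, innerSL_apply_apply, ContinuousLinearMap.proj_apply, this, weight,
    smul_eq_mul, Submodule.subtypeL_apply]
  ring

theorem mem_levelTangent_iff {z v : Fin n → ℂ} :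
    v ∈ levelTangent G z ↔
      ∀ ξ ∈ lieAlg G, ∑ l, ((starRingEnd ℂ) (z l) * v l).re * ξ l = 0 := by
  simp only [levelTangent, Set.mem_ofPred_eq, ContinuousLinearMap.ext_iff, fderiv_moment_apply,
    Subtype.forall, _root_.zero_apply, mul_eq_zero, OfNat.ofNat_ne_zero, false_or]

theorem levelTangent_sub {z v w : Fin n → ℂ} (hv : v ∈ levelTangent G z)
    (hw : w ∈ levelTangent G z) : v - w ∈ levelTangent G z := by
  simp only [levelTangent, Set.mem_ofPred_eq] at *
  rw [map_sub, hv, hw]; simp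

theorem smul_mem_levelTangent {g : Fin n → Circle} {z v : Fin n → ℂ}
    (hv : v ∈ levelTangent G z) : g • v ∈ levelTangent G (g • z) := by
  rw [mem_levelTangent_iff] at *
  intro ξ hξ
  rw [← hv ξ hξ]
  refine Finset.sum_congr rfl fun l _ => ?_
  have h : (starRingEnd ℂ) (g l : ℂ) * (g l : ℂ) = 1 := by
    rw [Complex.conj_mul', Circle.norm_coe]; simp
  simp only [Pi.smul_apply', Circle.smul_def, smul_eq_mul, map_mul]
  rw [show (starRingEnd ℂ) (g l : ℂ) * (starRingEnd ℂ) (z l) * ((g l : ℂ) * v l)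
    = ((starRingEnd ℂ) (g l : ℂ) * (g l : ℂ)) * ((starRingEnd ℂ) (z l) * v l) by ring, h, one_mul]

theorem stdForm_smul (g : Fin n → Circle) (v w : Fin n → ℂ) :
    stdForm (g • v) (g • w) = stdForm v w := by
  unfold stdForm
  congr 1
  refine Finset.sum_congr rfl fun l _ => ?_
  have h : (starRingEnd ℂ) (g l : ℂ) * (g l : ℂ) = 1 := by
    rw [Complex.conj_mul', Circle.norm_coe]; simp
  simp only [Pi.smul_apply', Circle.smul_def, smul_eq_mul, map_mul]
  rw [show (starRingEnd ℂ) (g l : ℂ) * (starRingEnd ℂ) (v l) * ((g l : ℂ) * w l)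
    = ((starRingEnd ℂ) (g l : ℂ) * (g l : ℂ)) * ((starRingEnd ℂ) (v l) * w l) by ring, h, one_mul]

/-- The tangent vector at `z` of the one-parameter group generated by `ξ`. -/
def orbitVec (ξ : Fin n → ℝ) (z : Fin n → ℂ) : Fin n → ℂ := fun l => Complex.I * ξ l * z l

/-- The moment map equation: pairing with the orbit direction of ξ is, up to sign, the ξ-component
of dψ. -/
theorem stdForm_orbitVec_left {z w : Fin n → ℂ} {ξ : Fin n → ℝ} (hξ : ξ ∈ lieAlg G)
    (hw : w ∈ levelTangent G z) : stdForm (orbitVec ξ z) w = 0 := by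
  have h := mem_levelTangent_iff.1 hw ξ hξ
  unfold stdForm orbitVec
  rw [mul_eq_zero]; right
  rw [← neg_eq_zero, ← h, ← Finset.sum_neg_distrib]
  refine Finset.sum_congr rfl fun l _ => ?_
  simp; ring

theorem stdForm_swap (v w : Fin n → ℂ) : stdForm w v = - stdForm v w := by
  unfold stdForm
  rw [← mul_neg, ← Finset.sum_neg_distrib]
  congr 1
  refine Finset.sum_congr rfl fun l _ => ?_
  simp; ring

theorem stdForm_add_left (v v' w : Fin n → ℂ) :
    stdForm (v + v') w = stdForm v w + stdForm v' w := by
  simp [stdForm, add_mul, Finset.sum_add_distrib]; ring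

theorem stdForm_add_right (v w w' : Fin n → ℂ) :
    stdForm v (w + w') = stdForm v w + stdForm v w' := by
  rw [stdForm_swap, stdForm_add_left, stdForm_swap w, stdForm_swap w']; ring

/-! ### The projection -/

theorem proj_eq_iff {x y : level G lam} :
    proj G lam x = proj G lam y ↔ ∃ g ∈ G, g • (y : Fin n → ℂ) = x := by
  rw [proj, Quotient.eq]
  constructor
  · rintro ⟨g, hg⟩
    exact ⟨g, g.2, hg⟩
  · rintro ⟨g, hg, h⟩
    exact ⟨⟨g, hg⟩, h⟩

theorem continuous_proj : Continuous (proj G lam) := continuous_quotient_mk'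

theorem isOpen_iff_preimage_proj {s : Set (ReducedSpace G lam)} :
    IsOpen s ↔ IsOpen (proj G lam ⁻¹' s) := Iff.rfl

theorem proj_surjective : Function.Surjective (proj G lam) := Quotient.mk_surjective

theorem potential_proj (c : Fin n → ℝ) (z : level G lam) :
    potential G lam c (proj G lam z) =
      ∑ l, (‖(z : Fin n → ℂ) l‖ ^ 2 - c l * Real.log (‖(z : Fin n → ℂ) l‖ ^ 2)) := rfl

theorem IsLocalExtension.apply_self [ChartedSpace (Model G) (ReducedSpace G lam)]
    {z : level G lam} {P : (Fin n → ℂ) → ReducedSpace G lam} (h : IsLocalExtension G lam z P) :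
    P z = proj G lam z := h.2.self_of_nhds

theorem IsLocalExtension.contDiffAt [ChartedSpace (Model G) (ReducedSpace G lam)]
    {z : level G lam} {P : (Fin n → ℂ) → ReducedSpace G lam} (h : IsLocalExtension G lam z P) :
    ContDiffAt ℝ ∞ (fun y => chartAt (Model G) (proj G lam z) (P y)) (z : Fin n → ℂ) := by
  have := (contMDiffAt_iff.1 h.1).2
  rw [h.apply_self] at this
  simp only [mfld_simps, contDiffWithinAt_univ] at this
  exact this

/-- Turns `differential` into an ordinary derivative in the preferred chart at the image point, so
that the chain rule in vector spaces applies. -/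
theorem IsLocalExtension.hasFDerivAt [ChartedSpace (Model G) (ReducedSpace G lam)]
    {z : level G lam} {P : (Fin n → ℂ) → ReducedSpace G lam} (h : IsLocalExtension G lam z P) :
    HasFDerivAt (fun y => chartAt (Model G) (proj G lam z) (P y)) (differential P z)
      (z : Fin n → ℂ) := by
  have h1 : MDifferentiableAt 𝓘(ℝ, Fin n → ℂ) 𝓘(ℝ, Model G) P (z : Fin n → ℂ) :=
    h.1.mdifferentiableAt (by simp)
  have h2 := h1.hasMFDerivAt.2
  have h3 := h.apply_self
  simp only [writtenInExtChartAt, extChartAt, mfld_simps] at h2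
  rw [← h3]
  exact hasFDerivWithinAt_univ.1 h2

end ToricReduction

end
noncomputable section

namespace ToricReduction

variable {n : ℕ} {G : Subgroup (Fin n → Circle)} {lam : lieAlg G →L[ℝ] ℝ}

/-! ### Vertices of the moment polytope -/

/-- A vertex of the moment polytope of `ψ⁻¹(lam)/G`. The equivalence `e` separates the coordinates
which do not vanish at the vertex from those that do, `l` collects the former, and the integral
matrix `a` describes `G` as the graph of a homomorphism between tori. -/
structure Vertex (G : Subgroup (Fin n → Circle)) (lam : lieAlg G →L[ℝ] ℝ) where
  e : Fin (Module.finrank ℝ (lieAlg G)) ⊕ Fin (n - Module.finrank ℝ (lieAlg G)) ≃ Fin n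
  a : Fin (Module.finrank ℝ (lieAlg G)) → Fin (n - Module.finrank ℝ (lieAlg G)) → ℤ
  l : Fin (Module.finrank ℝ (lieAlg G)) → ℝ
  l_pos : ∀ i, 0 < l i
  mem_lieAlg_iff : ∀ b : Fin n → ℝ, b ∈ lieAlg G ↔
    ∀ j, b (e (.inr j)) = ∑ i, (a i j : ℝ) * b (e (.inl i))
  mem_iff : ∀ g : Fin n → Circle, g ∈ G ↔ ∀ j, g (e (.inr j)) = ∏ i, g (e (.inl i)) ^ a i j
  lam_apply : ∀ ξ : lieAlg G, lam ξ = ∑ i, l i * (ξ : Fin n → ℝ) (e (.inl i))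

/-- The fibre of `(ℝ≥0)ⁿ → 𝔤*` over `lam`; it is the moment polytope. -/
def fiber (G : Subgroup (Fin n → Circle)) (lam : lieAlg G →L[ℝ] ℝ) : Set (Fin n → ℝ) :=
  {t | (∀ l, 0 ≤ t l) ∧ ∀ ξ : lieAlg G, ∑ l, t l * (ξ : Fin n → ℝ) l = lam ξ}

/-- The conormal directions of the fibres of `ℝⁿ → 𝔤*`. -/
def IsConormal (G : Subgroup (Fin n → Circle)) (s : Fin n → ℝ) : Prop :=
  ∀ ξ : lieAlg G, ∑ l, s l * (ξ : Fin n → ℝ) l = 0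

/-- The polarizing ξ has positive coordinates, so a nonnegative s with vanishing pairing would be
zero. This is what bounds the polytope. -/
theorem exists_neg_of_isConormal (hpol : Polarized G) {s : Fin n → ℝ} (hs : IsConormal G s)
    (h0 : s ≠ 0) : ∃ l, s l < 0 := by
  by_contra! h
  obtain ⟨ξ, hξ⟩ := hpol
  replace hξ : ∀ i, 0 < (ξ : Fin n → ℝ) i := hξ
  have h1 := (Finset.sum_eq_zero_iff_of_nonneg
    (fun l _ => mul_nonneg (h l) (hξ l).le)).1 (hs ξ)
  refine h0 (funext fun l => ?_)
  exact (mul_eq_zero.1 (h1 l (Finset.mem_univ l))).resolve_right (hξ l).ne'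

/-- Travel from t in the direction s until the first coordinate reaches zero. -/
theorem exists_smaller_support {t s : Fin n → ℝ} (ht : t ∈ fiber G lam)
    (hs : IsConormal G s) (hts : ∀ l, t l = 0 → s l = 0) {m : Fin n} (hm : s m < 0) :
    ∃ t' ∈ fiber G lam, (∀ l, t l = 0 → t' l = 0) ∧ ∃ l, t l ≠ 0 ∧ t' l = 0 := by
  obtain ⟨m₀, hm₀, hmin⟩ := Finset.exists_min_image (Finset.univ.filter fun l => s l < 0)
    (fun l => t l / (-s l)) ⟨m, by simpa using hm⟩
  simp only [Finset.mem_filter, Finset.mem_univ, true_and] at hm₀ hmin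
  -- The largest step that keeps all coordinates nonnegative; it is attained at `m₀`.
  set ε := t m₀ / (-s m₀) with hε
  have hε0 : 0 ≤ ε := div_nonneg (ht.1 m₀) (by linarith)
  refine ⟨fun l => t l + ε * s l, ⟨fun l => ?_, fun ξ => ?_⟩, fun l hl => ?_, m₀, ?_, ?_⟩
  · rcases lt_or_ge (s l) 0 with h | h
    · have := hmin l h
      rw [le_div_iff₀ (by linarith)] at this
      linarith
    · have := ht.1 l
      have := mul_nonneg hε0 h
      linarith
  · simp only [add_mul, Finset.sum_add_distrib, ht.2 ξ, mul_assoc, ← Finset.mul_sum, hs ξ]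
    simp
  · simp [hl, hts l hl]
  · exact fun h => hm₀.ne (hts m₀ h)
  · have : s m₀ ≠ 0 := hm₀.ne
    rw [hε]
    field_simp
    ring

theorem exists_extreme (hpol : Polarized G) (t : Fin n → ℝ) (ht : t ∈ fiber G lam) :
    ∃ t' ∈ fiber G lam, (∀ l, t l = 0 → t' l = 0) ∧
      ∀ s, IsConormal G s → (∀ l, t' l = 0 → s l = 0) → s = 0 := by
  induction hN : (Finset.univ.filter fun l => t l ≠ 0).card using Nat.strong_induction_on
    generalizing t with
  | _ N ih =>
    by_cases h : ∀ s, IsConormal G s → (∀ l, t l = 0 → s l = 0) → s = 0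
    · exact ⟨t, ht, fun _ h => h, h⟩
    · push Not at h
      obtain ⟨s, hs, hts, h0⟩ := h
      obtain ⟨m, hm⟩ := exists_neg_of_isConormal hpol hs h0
      obtain ⟨t', ht', h1, m₀, h2, h3⟩ := exists_smaller_support ht hs hts hm
      obtain ⟨t₂, ht₂, h4, h5⟩ := ih _ (by
        rw [← hN]
        refine Finset.card_lt_card (Finset.ssubset_iff_of_subset ?_ |>.2 ⟨m₀, ?_, ?_⟩)
        · intro l hl
          simp only [Finset.mem_filter, Finset.mem_univ, true_and] at hl ⊢
          exact fun h => hl (h1 l h)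
        · simpa using h2
        · simpa using h3) t' ht' rfl
      exact ⟨t₂, ht₂, fun l hl => h4 l (h1 l hl), h5⟩

theorem torusMoment_mem_fiber {z : Fin n → ℂ} (hz : z ∈ level G lam) :
    torusMoment z ∈ fiber G lam :=
  ⟨fun _ => sq_nonneg _, mem_level_iff.1 hz⟩

theorem exists_torusMoment_eq {t : Fin n → ℝ} (ht : t ∈ fiber G lam) :
    (fun l => ((Real.sqrt (t l) : ℝ) : ℂ)) ∈ level G lam ∧
      ∀ l, ((Real.sqrt (t l) : ℝ) : ℂ) = 0 ↔ t l = 0 := by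
  refine ⟨?_, fun l => ?_⟩
  · rw [mem_level_iff]
    intro ξ
    rw [← ht.2 ξ]
    refine Finset.sum_congr rfl fun l _ => ?_
    rw [Complex.norm_real, Real.norm_eq_abs, sq_abs, Real.sq_sqrt (ht.1 l)]
  · rw [Complex.ofReal_eq_zero, Real.sqrt_eq_zero (ht.1 l)]

/-- The differential of ψ at z only involves weights of coordinates with z_l ≠ 0, so everything in
its image kills b; by regularity every weight is in the image. -/
theorem eq_zero_of_regular (hreg : IsRegularValue G lam) {z : Fin n → ℂ} (hz : z ∈ level G lam)
    {b : Fin n → ℝ} (hb : b ∈ lieAlg G) (h : ∀ l, z l ≠ 0 → b l = 0) : b = 0 := by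
  funext m
  obtain ⟨v, hv⟩ := hreg z hz (weight G m)
  have h1 := fderiv_moment_apply z v ⟨b, hb⟩
  rw [hv] at h1
  change b m = 0
  change b m = _ at h1
  rw [h1, mul_eq_zero]; right
  refine Finset.sum_eq_zero fun l _ => ?_
  by_cases hl : z l = 0
  · simp [hl]
  · simp [h l hl]

/-- Restriction of the Lie algebra to a set of coordinates. -/
def restrictCoords (G : Subgroup (Fin n → Circle)) {ι : Type*} (s : ι → Fin n) :
    lieAlg G →ₗ[ℝ] (ι → ℝ) :=
  (LinearMap.funLeft ℝ ℝ s).comp (lieAlg G).subtype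

theorem restrictCoords_apply {ι : Type*} (s : ι → Fin n) (b : lieAlg G) (i : ι) :
    restrictCoords G s b i = (b : Fin n → ℝ) (s i) := rfl

/-- A functional annihilating the range, extended by zero, is a conormal vector supported on the
support of t; extremality forces it to vanish. -/
theorem restrictCoords_surjective {t : Fin n → ℝ} {ι : Type*} [Finite ι] {s : ι → Fin n}
    (hs : Function.Injective s) (hst : ∀ i, t (s i) ≠ 0)
    (ht : ∀ r, IsConormal G r → (∀ l, t l = 0 → r l = 0) → r = 0) :
    Function.Surjective (restrictCoords G s) := by
  classical
  have := Fintype.ofFinite ι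
  rw [← LinearMap.range_eq_top]
  by_contra h
  obtain ⟨f, hf, hle⟩ := Submodule.exists_le_ker_of_lt_top _ (lt_top_iff_ne_top.2 h)
  have hfs : ∀ x, f x = ∑ i, f (Pi.single i 1) * x i := fun x => by
    conv_lhs => rw [← Finset.univ_sum_single x, map_sum]
    refine Finset.sum_congr rfl fun i _ => ?_
    rw [show (Pi.single i (x i) : ι → ℝ) = x i • Pi.single i 1 by
      rw [← Pi.single_smul]; simp, map_smul, smul_eq_mul, mul_comm]
  set r : Fin n → ℝ := fun l => ∑ i, if s i = l then f (Pi.single i 1) else 0 with hr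
  have hrs : ∀ i, r (s i) = f (Pi.single i 1) := fun i => by
    simp [hr, hs.eq_iff]
  have h0 : r = 0 := by
    refine ht r (fun ξ => ?_) fun l hl => ?_
    · have h1 : f (restrictCoords G s ξ) = 0 := hle (LinearMap.mem_range_self _ ξ)
      rw [hfs] at h1
      rw [← h1]
      simp only [hr, Finset.sum_mul, restrictCoords_apply, ite_mul, zero_mul]
      rw [Finset.sum_comm]
      simp
    · refine Finset.sum_eq_zero fun i _ => if_neg ?_
      rintro rfl
      exact hst i hl
  refine hf (LinearMap.ext fun x => ?_)
  rw [hfs]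
  simp [← hrs, h0]

theorem Circle.exp_sum {ι : Type*} (s : Finset ι) (f : ι → ℝ) :
    Circle.exp (∑ i ∈ s, f i) = ∏ i ∈ s, Circle.exp (f i) := by
  classical
  induction s using Finset.induction_on with
  | empty => simp
  | insert i s hi ih => rw [Finset.sum_insert hi, Finset.prod_insert hi, Circle.exp_add, ih]

theorem exists_vertex (hpol : Polarized G) (hreg : IsRegularValue G lam)
    (hfree : ActsFreely G lam) {z : Fin n → ℂ} (hz : z ∈ level G lam) :
    ∃ V : Vertex G lam, ∀ i, z (V.e (.inl i)) ≠ 0 := by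
  classical
  obtain ⟨t, ht, htz, hext⟩ := exists_extreme hpol _ (torusMoment_mem_fiber hz)
  obtain ⟨hy, hyt⟩ := exists_torusMoment_eq ht
  set y : Fin n → ℂ := fun l => ((Real.sqrt (t l) : ℝ) : ℂ) with hydef
  have hinj : ∀ b ∈ lieAlg G, (∀ l, t l ≠ 0 → b l = 0) → b = 0 := fun b hb h =>
    eq_zero_of_regular hreg hy hb fun l hl => h l (fun h' => hl ((hyt l).2 h'))
  -- Injectivity comes from regularity, surjectivity from extremality. Hence the vertex has exactly
  -- dim G nonzero coordinates, which makes the splitting `e` possible.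
  have hbijS : Function.Bijective (restrictCoords G (Subtype.val : {l // t l ≠ 0} → Fin n)) := by
    refine ⟨(injective_iff_map_eq_zero _).2 fun b hb => ?_,
      restrictCoords_surjective Subtype.val_injective (fun i => i.2) hext⟩
    exact Subtype.ext (hinj b b.2 fun l hl => congrFun hb ⟨l, hl⟩)
  have hcard : Fintype.card {l // t l ≠ 0} = Module.finrank ℝ (lieAlg G) := by
    rw [(LinearEquiv.ofBijective _ hbijS).finrank_eq, Module.finrank_fintype_fun_eq_card]
  have hcard' : Fintype.card {l // ¬ t l ≠ 0} = n - Module.finrank ℝ (lieAlg G) := by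
    rw [Fintype.card_subtype_compl, hcard, Fintype.card_fin]
  let e := ((Fintype.equivFinOfCardEq hcard).symm.sumCongr
    (Fintype.equivFinOfCardEq hcard').symm).trans (Equiv.sumCompl fun l => t l ≠ 0)
  have hs : ∀ i, t (e (.inl i)) ≠ 0 := fun i =>
    ((Fintype.equivFinOfCardEq hcard).symm i).2
  have hc : ∀ j, t (e (.inr j)) = 0 := fun j =>
    not_not.1 ((Fintype.equivFinOfCardEq hcard').symm j).2
  clear_value e
  have hbij : Function.Bijective (restrictCoords G fun i => e (.inl i)) := by
    refine ⟨(injective_iff_map_eq_zero _).2 fun b hb => ?_,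
      restrictCoords_surjective (fun i i' h => Sum.inl_injective (e.injective h)) hs hext⟩
    refine Subtype.ext (hinj b b.2 fun l hl => ?_)
    obtain ⟨i | j, rfl⟩ := e.surjective l
    · exact congrFun hb i
    · exact absurd (hc j) hl
  let ρ := LinearEquiv.ofBijective _ hbij
  have hρ : ∀ b : lieAlg G, ∀ i, ρ b i = (b : Fin n → ℝ) (e (.inl i)) := fun b i => rfl
  let η : Fin (Module.finrank ℝ (lieAlg G)) → lieAlg G := fun i => ρ.symm (Pi.single i 1)
  have hη : ∀ i i', (η i : Fin n → ℝ) (e (.inl i')) = if i' = i then 1 else 0 := fun i i' => by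
    rw [← hρ, LinearEquiv.apply_symm_apply, Pi.single_apply]
  have hexpand : ∀ b : lieAlg G, b = ∑ i, (b : Fin n → ℝ) (e (.inl i)) • η i := fun b => by
    apply ρ.injective
    funext i'
    rw [hρ, hρ]
    simp [hη]
  -- Such g fixes the point y over the vertex, whose remaining coordinates are zero, so freeness
  -- applies.
  have hstab : ∀ g ∈ G, (∀ i, g (e (.inl i)) = 1) → g = 1 := fun g hg h => by
    refine hfree y hy g hg (funext fun l => ?_)
    obtain ⟨i | j, rfl⟩ := e.surjective l
    · simp [h]
    · have : y (e (.inr j)) = 0 := (hyt _).2 (hc j)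
      simp [Pi.smul_apply', this]
  -- At time 2π the one-parameter group of `η i` is trivial on the nonvanishing coordinates, hence
  -- trivial by `hstab`; the other coordinates of `η i` are then integers.
  have hint : ∀ i j, ∃ m : ℤ, (η i : Fin n → ℝ) (e (.inr j)) = m := fun i j => by
    have h1 := hstab _ ((η i).2 (2 * Real.pi)) fun i' => by
      rw [hη]
      split_ifs <;> simp
    have h2 := congrFun h1 (e (.inr j))
    obtain ⟨m, hm⟩ := Circle.exp_eq_one.1 h2
    refine ⟨m, ?_⟩
    have := Real.pi_pos
    nlinarith
  choose a ha using hint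
  have hlie : ∀ b : Fin n → ℝ, b ∈ lieAlg G ↔
      ∀ j, b (e (.inr j)) = ∑ i, (a i j : ℝ) * b (e (.inl i)) := fun b => by
    have key : ∀ b : lieAlg G, ∀ j, (b : Fin n → ℝ) (e (.inr j)) =
        ∑ i, (a i j : ℝ) * (b : Fin n → ℝ) (e (.inl i)) := fun b j => by
      conv_lhs => rw [hexpand b]
      simp [ha, mul_comm]
    refine ⟨fun hb => key ⟨b, hb⟩, fun h => ?_⟩
    have h2 : b = (∑ i, b (e (.inl i)) • η i : lieAlg G) := by
      funext l
      obtain ⟨i | j, rfl⟩ := e.surjective l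
      · simp [hη]
      · rw [h, key]
        simp [hη]
    rw [h2]
    exact Subtype.coe_prop _
  -- Arguments of the nonvanishing coordinates lift to 𝔤. Together with `hstab` this identifies each
  -- element of `G` with an exponential.
  have hexp : ∀ g : Fin n → Circle, ∃ b ∈ lieAlg G, ∀ i,
      g (e (.inl i)) = Circle.exp (1 * b (e (.inl i))) := fun g => by
    refine ⟨ρ.symm fun i => Complex.arg (g (e (.inl i))), Subtype.coe_prop _, fun i => ?_⟩
    rw [← hρ, LinearEquiv.apply_symm_apply, one_mul, Circle.exp_arg]
  have hexp' : ∀ b ∈ lieAlg G, ∀ j, Circle.exp (1 * b (e (.inr j))) =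
      ∏ i, Circle.exp (1 * b (e (.inl i))) ^ a i j := fun b hb j => by
    rw [(hlie b).1 hb j, one_mul, Circle.exp_sum]
    refine Finset.prod_congr rfl fun i _ => ?_
    rw [one_mul, ← Circle.exp_zsmul, zsmul_eq_mul]
  refine ⟨⟨e, a, fun i => t (e (.inl i)), fun i => (ht.1 _).lt_of_ne' (hs i), hlie,
    fun g => ?_, fun ξ => ?_⟩, fun i h => hs i (htz _ ?_)⟩
  · obtain ⟨b, hb, hgb⟩ := hexp g
    constructor
    · intro hg j
      have h1 := hstab _ (G.mul_mem hg (G.inv_mem (hb 1))) fun i => by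
        simp only [Pi.mul_apply, Pi.inv_apply, hgb, mul_inv_cancel]
      rw [mul_inv_eq_one] at h1
      rw [h1]
      exact hexp' b hb j
    · intro h
      have : g = fun l => Circle.exp (1 * b l) := by
        funext l
        obtain ⟨i | j, rfl⟩ := e.surjective l
        · exact hgb i
        · rw [h, hexp' b hb j]
          exact Finset.prod_congr rfl fun i _ => by rw [hgb]
      rw [this]
      exact hb 1
  · rw [← ht.2 ξ, ← e.sum_comp, Fintype.sum_sum_type]
    simp [hc]
  · simp only [torusMoment]
    rw [h]
    simp

end ToricReduction

end
noncomputable section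

namespace ToricReduction

namespace Vertex

variable {n : ℕ} {G : Subgroup (Fin n → Circle)} {lam : lieAlg G →L[ℝ] ℝ} (V : Vertex G lam)

/-! ### The toric chart at a vertex -/

/-- The coordinates which do not vanish at the vertex. -/
abbrev s (i : Fin (Module.finrank ℝ (lieAlg G))) : Fin n := V.e (.inl i)

/-- The coordinates which vanish at the vertex. -/
abbrev t (j : Fin (n - Module.finrank ℝ (lieAlg G))) : Fin n := V.e (.inr j)

theorem sum_eq {M : Type*} [AddCommMonoid M] (f : Fin n → M) :
    ∑ l, f l = ∑ i, f (V.s i) + ∑ j, f (V.t j) := by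
  rw [← V.e.sum_comp, Fintype.sum_sum_type]

/-- Combine values on the two kinds of coordinates. -/
def glue {α : Type*} (f : Fin (Module.finrank ℝ (lieAlg G)) → α)
    (g : Fin (n - Module.finrank ℝ (lieAlg G)) → α) : Fin n → α :=
  fun l => Sum.elim f g (V.e.symm l)

@[simp] theorem glue_s {α : Type*} (f : Fin (Module.finrank ℝ (lieAlg G)) → α)
    (g : Fin (n - Module.finrank ℝ (lieAlg G)) → α) (i) : V.glue f g (V.e (.inl i)) = f i := by
  simp [glue]

@[simp] theorem glue_t {α : Type*} (f : Fin (Module.finrank ℝ (lieAlg G)) → α)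
    (g : Fin (n - Module.finrank ℝ (lieAlg G)) → α) (j) : V.glue f g (V.e (.inr j)) = g j := by
  simp [glue]

theorem funext_coords {α : Type*} {f g : Fin n → α} (h1 : ∀ i, f (V.s i) = g (V.s i))
    (h2 : ∀ j, f (V.t j) = g (V.t j)) : f = g := by
  funext l
  obtain ⟨i | j, rfl⟩ := V.e.surjective l
  exacts [h1 i, h2 j]

/-- The logarithm of the monomial with exponents `a · j`. -/
def mon (b : Fin (Module.finrank ℝ (lieAlg G)) → ℝ)
    (j : Fin (n - Module.finrank ℝ (lieAlg G))) : ℝ := ∑ i, (V.a i j : ℝ) * b i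

theorem glue_mon_mem (b : Fin (Module.finrank ℝ (lieAlg G)) → ℝ) :
    V.glue b (V.mon b) ∈ lieAlg G := by
  rw [V.mem_lieAlg_iff]
  simp [mon]

theorem sum_mul_mon (f : Fin (n - Module.finrank ℝ (lieAlg G)) → ℝ)
    (b : Fin (Module.finrank ℝ (lieAlg G)) → ℝ) :
    ∑ j, f j * V.mon b j = ∑ i, (∑ j, (V.a i j : ℝ) * f j) * b i := by
  simp only [mon, Finset.mul_sum, Finset.sum_mul]
  rw [Finset.sum_comm]
  exact Finset.sum_congr rfl fun i _ => Finset.sum_congr rfl fun j _ => by ring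

/-- The coordinates indexed by `V.s` are free parameters on 𝔤, so functionals on 𝔤 can be compared
coefficientwise. The level set, its tangent spaces and the condition on c all become explicit
equations this way. -/
theorem pairing_iff (T : Fin n → ℝ) (c : Fin (Module.finrank ℝ (lieAlg G)) → ℝ) :
    (∀ ξ ∈ lieAlg G, ∑ l, T l * ξ l = ∑ i, c i * ξ (V.s i)) ↔
      ∀ i, T (V.s i) + ∑ j, (V.a i j : ℝ) * T (V.t j) = c i := by
  have key : ∀ ξ ∈ lieAlg G, ∑ l, T l * ξ l =
      ∑ i, (T (V.s i) + ∑ j, (V.a i j : ℝ) * T (V.t j)) * ξ (V.s i) := fun ξ hξ => by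
    rw [V.sum_eq]
    simp only [add_mul, Finset.sum_add_distrib]
    rw [← V.sum_mul_mon]
    congr 1
    exact Finset.sum_congr rfl fun j _ => by rw [(V.mem_lieAlg_iff ξ).1 hξ j]; rfl
  constructor
  · intro h i
    have h1 := h _ (V.glue_mon_mem (Pi.single i 1))
    rw [key _ (V.glue_mon_mem (Pi.single i 1))] at h1
    simpa [Pi.single_apply] using h1
  · intro h ξ hξ
    rw [key ξ hξ]
    simp only [h]

theorem mem_level_iff {z : Fin n → ℂ} : z ∈ level G lam ↔
    ∀ i, ‖z (V.s i)‖ ^ 2 + ∑ j, (V.a i j : ℝ) * ‖z (V.t j)‖ ^ 2 = V.l i := by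
  rw [← V.pairing_iff (fun l => ‖z l‖ ^ 2) V.l, ToricReduction.mem_level_iff]
  simp only [V.lam_apply, Subtype.forall]

theorem mem_levelTangent_iff {z v : Fin n → ℂ} : v ∈ levelTangent G z ↔
    ∀ i, ((starRingEnd ℂ) (z (V.s i)) * v (V.s i)).re +
      ∑ j, (V.a i j : ℝ) * ((starRingEnd ℂ) (z (V.t j)) * v (V.t j)).re = 0 := by
  rw [← V.pairing_iff (fun l => ((starRingEnd ℂ) (z l) * v l).re) (fun _ => 0),
    ToricReduction.mem_levelTangent_iff]
  simp

/-- The holomorphic coordinates at the vertex, as functions on `ℂⁿ`. -/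
def coord (z : Fin n → ℂ) : Model G := fun j => z (V.t j) * ∏ i, z (V.s i) ^ (-V.a i j)

/-- Invariance under the complexified torus; its compact and its real exponential directions are
`coord_smul` and `coord_exp_mul`. -/
theorem coord_mul {c : Fin n → ℂ} (h0 : ∀ i, c (V.s i) ≠ 0)
    (hc : ∀ j, c (V.t j) = ∏ i, c (V.s i) ^ V.a i j) (z : Fin n → ℂ) :
    V.coord (fun l => c l * z l) = V.coord z := by
  funext j
  simp only [coord, hc, mul_zpow, Finset.prod_mul_distrib]
  have h : (∏ i, c (V.s i) ^ V.a i j) * ∏ i, c (V.s i) ^ (-V.a i j) = 1 := by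
    rw [← Finset.prod_mul_distrib]
    refine Finset.prod_eq_one fun i _ => ?_
    rw [← zpow_add₀ (h0 i), add_neg_cancel, zpow_zero]
  calc _ = ((∏ i, c (V.s i) ^ V.a i j) * ∏ i, c (V.s i) ^ (-V.a i j)) *
        (z (V.t j) * ∏ i, z (V.s i) ^ (-V.a i j)) := by ring
    _ = _ := by rw [h, one_mul]

theorem coe_prod_zpow {ι : Type*} [Fintype ι] (g : ι → Circle) (m : ι → ℤ) :
    ((∏ i, g i ^ m i : Circle) : ℂ) = ∏ i, (g i : ℂ) ^ m i := by
  refine (map_prod Circle.coeHom _ _).trans (Finset.prod_congr rfl fun i _ => ?_)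
  exact map_zpow Circle.coeHom _ _

theorem coord_smul {g : Fin n → Circle} (hg : g ∈ G) (z : Fin n → ℂ) :
    V.coord (g • z) = V.coord z := by
  refine V.coord_mul (c := fun l => (g l : ℂ)) (fun i => Circle.coe_ne_zero _) (fun j => ?_) z
  rw [(V.mem_iff g).1 hg j, coe_prod_zpow]

theorem coord_exp_mul {b : Fin n → ℝ} (hb : b ∈ lieAlg G) (z : Fin n → ℂ) :
    V.coord (fun l => (Real.exp (b l) : ℂ) * z l) = V.coord z := by
  refine V.coord_mul (c := fun l => (Real.exp (b l) : ℂ))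
    (fun i => by exact_mod_cast (Real.exp_pos _).ne') (fun j => ?_) z
  rw [(V.mem_lieAlg_iff b).1 hb j, Real.exp_sum]
  push_cast
  refine Finset.prod_congr rfl fun i _ => ?_
  rw [← Complex.exp_int_mul]

/-! ### Solving the level set equations by convexity -/

/-- The equations whose solution `b` moves the point with coordinates `(1, w)` into the level set,
through the action of `exp (i 𝔤)`. -/
def eqn (w : Model G) (b : Fin (Module.finrank ℝ (lieAlg G)) → ℝ) :
    Fin (Module.finrank ℝ (lieAlg G)) → ℝ :=
  fun i => Real.exp (2 * b i) +
    ∑ j, (V.a i j : ℝ) * (Real.exp (2 * V.mon b j) * ‖w j‖ ^ 2) - V.l i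

/-- The image of the chart at the vertex. -/
def domain : Set (Model G) := {w | ∃ b, V.eqn w b = 0}

/-- The solution of `eqn`. -/
def sol (w : Model G) : Fin (Module.finrank ℝ (lieAlg G)) → ℝ :=
  Classical.epsilon fun b => V.eqn w b = 0

theorem eqn_sol {w : Model G} (hw : w ∈ V.domain) : V.eqn w (V.sol w) = 0 :=
  Classical.epsilon_spec hw

theorem exp_sub_mul_nonneg (x y : ℝ) :
    0 ≤ (Real.exp (2 * x) - Real.exp (2 * y)) * (x - y) := by
  rcases le_total x y with h | h
  · exact mul_nonneg_of_nonpos_of_nonpos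
      (sub_nonpos.2 (Real.exp_le_exp.2 (by linarith))) (sub_nonpos.2 h)
  · exact mul_nonneg (sub_nonneg.2 (Real.exp_le_exp.2 (by linarith))) (sub_nonneg.2 h)

theorem mon_sub (b b' : Fin (Module.finrank ℝ (lieAlg G)) → ℝ) (j) :
    V.mon (b - b') j = V.mon b j - V.mon b' j := by
  simp [mon, mul_sub]

/-- Strict monotonicity of the gradient of a strictly convex function: pairing the difference of
values with b - b' gives a sum of nonnegative terms, and those indexed by i already separate b from
b'. -/
theorem eqn_injective {w : Model G} {b b' : Fin (Module.finrank ℝ (lieAlg G)) → ℝ}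
    (h : V.eqn w b = V.eqn w b') : b = b' := by
  have h1 : ∑ i, (Real.exp (2 * b i) - Real.exp (2 * b' i)) * (b i - b' i) +
      ∑ j, ‖w j‖ ^ 2 * ((Real.exp (2 * V.mon b j) - Real.exp (2 * V.mon b' j)) *
        (V.mon b j - V.mon b' j)) = 0 := by
    have h2 : ∑ i, (V.eqn w b i - V.eqn w b' i) * (b i - b' i) = 0 := by simp [h]
    rw [← h2]
    have h3 := V.sum_mul_mon (fun j => ‖w j‖ ^ 2 * (Real.exp (2 * V.mon b j)
      - Real.exp (2 * V.mon b' j))) (b - b')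
    simp only [mon_sub, mul_assoc] at h3
    rw [h3, ← Finset.sum_add_distrib]
    refine Finset.sum_congr rfl fun i _ => ?_
    simp only [eqn, Pi.sub_apply]
    rw [← add_mul]
    congr 1
    have : ∑ j, (V.a i j : ℝ) * (‖w j‖ ^ 2 * (Real.exp (2 * V.mon b j)
      - Real.exp (2 * V.mon b' j))) = ∑ j, (V.a i j : ℝ) * (Real.exp (2 * V.mon b j) * ‖w j‖ ^ 2)
      - ∑ j, (V.a i j : ℝ) * (Real.exp (2 * V.mon b' j) * ‖w j‖ ^ 2) := by
      rw [← Finset.sum_sub_distrib]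
      exact Finset.sum_congr rfl fun j _ => by ring
    rw [this]
    ring
  have h2 : 0 ≤ ∑ j, ‖w j‖ ^ 2 * ((Real.exp (2 * V.mon b j) - Real.exp (2 * V.mon b' j)) *
        (V.mon b j - V.mon b' j)) :=
    Finset.sum_nonneg fun j _ => mul_nonneg (sq_nonneg _) (exp_sub_mul_nonneg _ _)
  have h3 : ∑ i, (Real.exp (2 * b i) - Real.exp (2 * b' i)) * (b i - b' i) = 0 :=
    le_antisymm (by linarith) (Finset.sum_nonneg fun i _ => exp_sub_mul_nonneg _ _)
  rw [Finset.sum_eq_zero_iff_of_nonneg fun i _ => exp_sub_mul_nonneg _ _] at h3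
  funext i
  rcases mul_eq_zero.1 (h3 i (Finset.mem_univ i)) with h | h
  · have := Real.exp_injective (sub_eq_zero.1 h)
    linarith
  · linarith

theorem sol_eq {w : Model G} {b : Fin (Module.finrank ℝ (lieAlg G)) → ℝ} (h : V.eqn w b = 0) :
    V.sol w = b :=
  V.eqn_injective ((V.eqn_sol ⟨b, h⟩).trans h.symm)

theorem contDiff_mon : ContDiff ℝ ∞ V.mon := by
  unfold mon
  fun_prop

theorem contDiff_eqn : ContDiff ℝ ∞ fun p : Model G × (Fin (Module.finrank ℝ (lieAlg G)) → ℝ) =>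
    V.eqn p.1 p.2 := by
  rw [contDiff_pi]
  intro i
  have h1 : ∀ j, ContDiff ℝ ∞
      fun p : Model G × (Fin (Module.finrank ℝ (lieAlg G)) → ℝ) => ‖p.1 j‖ ^ 2 :=
    fun j => ContDiff.norm_sq ℝ (by fun_prop)
  have h2 : ∀ j, ContDiff ℝ ∞
      fun p : Model G × (Fin (Module.finrank ℝ (lieAlg G)) → ℝ) => V.mon p.2 j :=
    fun j => by unfold mon; fun_prop
  unfold eqn
  fun_prop

theorem hasDerivAt_mon {b : ℝ → Fin (Module.finrank ℝ (lieAlg G)) → ℝ}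
    {b' : Fin (Module.finrank ℝ (lieAlg G)) → ℝ} {x : ℝ} (hb : HasDerivAt b b' x) (j) :
    HasDerivAt (fun y => V.mon (b y) j) (V.mon b' j) x := by
  unfold mon
  exact HasDerivAt.fun_sum fun i _ => ((hasDerivAt_pi.1 hb) i).const_mul _

theorem hasDerivAt_norm_sq {f : ℝ → ℂ} {f' : ℂ} {x : ℝ} (hf : HasDerivAt f f' x) :
    HasDerivAt (fun y => ‖f y‖ ^ 2) (2 * ((starRingEnd ℂ) (f x) * f').re) x := by
  have := hf.norm_sq
  rwa [inner_eq_re_conj_mul] at this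

theorem hasDerivAt_eqn {w : ℝ → Model G} {b : ℝ → Fin (Module.finrank ℝ (lieAlg G)) → ℝ}
    {w' : Model G} {b' : Fin (Module.finrank ℝ (lieAlg G)) → ℝ} {x : ℝ}
    (hw : HasDerivAt w w' x) (hb : HasDerivAt b b' x) (i) :
    HasDerivAt (fun y => V.eqn (w y) (b y) i) (2 * Real.exp (2 * b x i) * b' i +
      ∑ j, (V.a i j : ℝ) * (2 * Real.exp (2 * V.mon (b x) j) * V.mon b' j * ‖w x j‖ ^ 2 +
        2 * Real.exp (2 * V.mon (b x) j) * ((starRingEnd ℂ) (w x j) * w' j).re)) x := by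
  unfold eqn
  refine (HasDerivAt.add ?_ (HasDerivAt.fun_sum fun j _ => ?_)).sub_const _
  · refine ((hasDerivAt_pi.1 hb i).const_mul 2).exp.congr_deriv ?_
    ring
  · refine (((((V.hasDerivAt_mon hb j).const_mul 2).exp).mul
      (hasDerivAt_norm_sq (hasDerivAt_pi.1 hw j))).const_mul (V.a i j : ℝ)).congr_deriv ?_
    ring

/-- The partial derivative in b is a positive definite Hessian: paired with δ it is a weighted sum
of squares with positive weights on the δ_i. -/
theorem fderiv_eqn_inr_injective (w : Model G) (b : Fin (Module.finrank ℝ (lieAlg G)) → ℝ) :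
    Function.Injective ((fderiv ℝ (fun p : Model G × (Fin (Module.finrank ℝ (lieAlg G)) → ℝ) =>
      V.eqn p.1 p.2) (w, b)).comp (ContinuousLinearMap.inr ℝ _ _)) := by
  rw [injective_iff_map_eq_zero]
  intro δ hδ
  have hb : HasDerivAt (fun y : ℝ => b + y • δ) δ 0 := by
    simpa using ((hasDerivAt_id (0 : ℝ)).smul_const δ).const_add b
  have hw : HasDerivAt (fun _ : ℝ => w) 0 (0 : ℝ) := hasDerivAt_const _ _
  have hd := ((V.contDiff_eqn.differentiable (by simp)) (w, b)).hasFDerivAt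
  have h1 := hd.comp_hasDerivAt_of_eq (0 : ℝ) (hw.prodMk hb) (by simp)
  change (fderiv ℝ (fun p : Model G × (Fin (Module.finrank ℝ (lieAlg G)) → ℝ) =>
      V.eqn p.1 p.2) (w, b)) (0, δ) = 0 at hδ
  rw [hδ] at h1
  have h2 : ∀ i, 2 * Real.exp (2 * b i) * δ i +
      ∑ j, (V.a i j : ℝ) * (2 * Real.exp (2 * V.mon b j) * V.mon δ j * ‖w j‖ ^ 2) = 0 :=
    fun i => by
      have := (V.hasDerivAt_eqn hw hb i).unique (hasDerivAt_pi.1 h1 i)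
      simpa using this
  have h3 : ∑ i, 2 * Real.exp (2 * b i) * δ i ^ 2 +
      ∑ j, 2 * Real.exp (2 * V.mon b j) * ‖w j‖ ^ 2 * V.mon δ j ^ 2 = 0 := by
    have h4 := V.sum_mul_mon (fun j => 2 * Real.exp (2 * V.mon b j) * V.mon δ j * ‖w j‖ ^ 2) δ
    have h5 : ∑ i, (2 * Real.exp (2 * b i) * δ i +
      ∑ j, (V.a i j : ℝ) * (2 * Real.exp (2 * V.mon b j) * V.mon δ j * ‖w j‖ ^ 2)) * δ i = 0 := by
      simp [h2]
    simp only [add_mul, Finset.sum_add_distrib] at h5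
    rw [← h4] at h5
    rw [← h5]
    congr 1
    · exact Finset.sum_congr rfl fun i _ => by ring
    · exact Finset.sum_congr rfl fun j _ => by ring
  have h4 : 0 ≤ ∑ j, 2 * Real.exp (2 * V.mon b j) * ‖w j‖ ^ 2 * V.mon δ j ^ 2 :=
    Finset.sum_nonneg fun j _ => by positivity
  have h5 : ∑ i, 2 * Real.exp (2 * b i) * δ i ^ 2 = 0 :=
    le_antisymm (by linarith) (Finset.sum_nonneg fun i _ => by positivity)
  rw [Finset.sum_eq_zero_iff_of_nonneg fun i _ => by positivity] at h5
  funext i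
  simpa [(Real.exp_pos _).ne'] using h5 i (Finset.mem_univ i)

/-- The implicit function theorem gives a smooth local solution, and uniqueness identifies it with
`sol`. The same argument shows that the domain is open. -/
theorem exists_smooth_sol {w : Model G} (hw : w ∈ V.domain) :
    ∀ᶠ w' in 𝓝 w, w' ∈ V.domain ∧ ContDiffAt ℝ ∞ V.sol w' := by
  have main : ∀ w ∈ V.domain, ContDiffAt ℝ ∞ V.sol w ∧ ∀ᶠ w' in 𝓝 w, w' ∈ V.domain := by
    intro w hw
    have hinv : ((fderiv ℝ (fun p : Model G × (Fin (Module.finrank ℝ (lieAlg G)) → ℝ) =>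
        V.eqn p.1 p.2) (w, V.sol w)).comp (ContinuousLinearMap.inr ℝ _ _)).IsInvertible :=
      ⟨(LinearEquiv.ofInjectiveEndo _
        (V.fderiv_eqn_inr_injective w (V.sol w))).toContinuousLinearEquiv, by ext; rfl⟩
    have hf := V.contDiff_eqn.contDiffAt (x := (w, V.sol w))
    have h1 := hf.eventually_apply_implicitFunction (by simp) hinv
    have h2 := hf.contDiffAt_implicitFunction (by simp) hinv
    simp only [V.eqn_sol hw] at h1
    refine ⟨h2.congr_of_eventuallyEq ?_, ?_⟩
    · filter_upwards [h1] with x hx using V.sol_eq hx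
    · filter_upwards [h1] with x hx using ⟨_, hx⟩
  filter_upwards [(main w hw).2] with w' hw' using ⟨hw', (main w' hw').1⟩

theorem isOpen_domain : IsOpen V.domain :=
  isOpen_iff_mem_nhds.2 fun _ hw => (V.exists_smooth_sol hw).mono fun _ h => h.1

theorem contDiffAt_sol {w : Model G} (hw : w ∈ V.domain) : ContDiffAt ℝ ∞ V.sol w :=
  (V.exists_smooth_sol hw).self_of_nhds.2

/-- The point of the level set with coordinates `w` on which the other coordinates are positive. -/
def lift (w : Model G) : Fin n → ℂ :=
  V.glue (fun i => (Real.exp (V.sol w i) : ℂ))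
    (fun j => w j * (Real.exp (V.mon (V.sol w) j) : ℂ))

theorem lift_s (w : Model G) (i) : V.lift w (V.s i) = (Real.exp (V.sol w i) : ℂ) := by
  simp [lift]

theorem lift_t (w : Model G) (j) :
    V.lift w (V.t j) = w j * (Real.exp (V.mon (V.sol w) j) : ℂ) := by
  simp [lift]

theorem lift_s_ne_zero (w : Model G) (i) : V.lift w (V.s i) ≠ 0 := by
  rw [lift_s]
  exact_mod_cast (Real.exp_pos _).ne'

/-- Exhibits the lift as (1, w) moved by the real exponential of an element of 𝔤, which invariant
monomials do not see. -/
theorem lift_eq (w : Model G) : V.lift w = fun l =>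
    (Real.exp (V.glue (V.sol w) (V.mon (V.sol w)) l) : ℂ) * V.glue (fun _ => 1) w l :=
  V.funext_coords (fun i => by simp [lift]) (fun j => by simp [lift, mul_comm])

theorem coord_lift (w : Model G) : V.coord (V.lift w) = w := by
  rw [lift_eq, V.coord_exp_mul (V.glue_mon_mem _)]
  funext j
  simp [coord]

theorem norm_exp_ofReal_sq (x : ℝ) : ‖(Real.exp x : ℂ)‖ ^ 2 = Real.exp (2 * x) := by
  rw [Complex.norm_real, Real.norm_eq_abs, sq_abs, ← Real.exp_nat_mul]
  norm_num

theorem lift_mem_level {w : Model G} (hw : w ∈ V.domain) : V.lift w ∈ level G lam := by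
  rw [V.mem_level_iff]
  intro i
  have h := congrFun (V.eqn_sol hw) i
  simp only [lift_s, lift_t, norm_mul, mul_pow, norm_exp_ofReal_sq]
  simp only [eqn, Pi.zero_apply, sub_eq_zero] at h
  rw [← h]
  congr 1
  exact Finset.sum_congr rfl fun j _ => by ring

theorem eq_coord_mul {z : Fin n → ℂ} (h0 : ∀ i, z (V.s i) ≠ 0) (j) :
    z (V.t j) = V.coord z j * ∏ i, z (V.s i) ^ V.a i j := by
  have h : (∏ i, z (V.s i) ^ (-V.a i j)) * ∏ i, z (V.s i) ^ V.a i j = 1 := by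
    rw [← Finset.prod_mul_distrib]
    refine Finset.prod_eq_one fun i _ => ?_
    rw [← zpow_add₀ (h0 i), neg_add_cancel, zpow_zero]
  rw [coord, mul_assoc, h, mul_one]

theorem exp_mon_log {z : Fin n → ℂ} (h0 : ∀ i, z (V.s i) ≠ 0) (j) :
    Real.exp (V.mon (fun i => Real.log ‖z (V.s i)‖) j) = ∏ i, ‖z (V.s i)‖ ^ V.a i j := by
  rw [mon, Real.exp_sum]
  refine Finset.prod_congr rfl fun i _ => ?_
  rw [mul_comm, Real.exp_mul, Real.rpow_intCast, Real.exp_log (norm_pos_iff.2 (h0 i))]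

/-- Substituting the logarithms of the moduli turns `eqn` back into the level set equations of z. -/
theorem eqn_coord {z : Fin n → ℂ} (hz : z ∈ level G lam) (h0 : ∀ i, z (V.s i) ≠ 0) :
    V.eqn (V.coord z) (fun i => Real.log ‖z (V.s i)‖) = 0 := by
  funext i
  have hexp : ∀ x : ℝ, Real.exp (2 * x) = Real.exp x ^ 2 := fun x => by
    rw [← Real.exp_nat_mul]; norm_num
  simp only [eqn, Pi.zero_apply, sub_eq_zero]
  rw [← V.mem_level_iff.1 hz i, hexp, Real.exp_log (norm_pos_iff.2 (h0 i))]
  congr 1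
  refine Finset.sum_congr rfl fun j _ => ?_
  rw [hexp, V.exp_mon_log h0, V.eq_coord_mul h0 j, norm_mul, norm_prod, mul_pow]
  simp only [norm_zpow]
  ring

theorem coord_mem_domain {z : Fin n → ℂ} (hz : z ∈ level G lam) (h0 : ∀ i, z (V.s i) ≠ 0) :
    V.coord z ∈ V.domain := ⟨_, V.eqn_coord hz h0⟩

theorem exists_smul_lift_coord {z : Fin n → ℂ} (hz : z ∈ level G lam)
    (h0 : ∀ i, z (V.s i) ≠ 0) : ∃ g ∈ G, g • V.lift (V.coord z) = z := by
  have hsol : V.sol (V.coord z) = fun i => Real.log ‖z (V.s i)‖ := V.sol_eq (V.eqn_coord hz h0)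
  -- The moduli of z and of the lift agree, so only phases remain; the phases of the nonvanishing
  -- coordinates determine the element of `G`, a graph over them.
  let θ : Fin (Module.finrank ℝ (lieAlg G)) → Circle := fun i => Circle.exp (Complex.arg (z (V.s i)))
  have hθ : ∀ i, (θ i : ℂ) * (‖z (V.s i)‖ : ℂ) = z (V.s i) := fun i => by
    rw [Circle.coe_exp, mul_comm, Complex.norm_mul_exp_arg_mul_I]
  refine ⟨V.glue θ fun j => ∏ i, θ i ^ V.a i j, (V.mem_iff _).2 fun j => by simp,
    V.funext_coords (fun i => ?_) fun j => ?_⟩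
  · rw [Pi.smul_apply', glue_s, lift_s, hsol, Real.exp_log (norm_pos_iff.2 (h0 i)),
      Circle.smul_def, smul_eq_mul, hθ]
  · rw [Pi.smul_apply', glue_t, lift_t, hsol, V.exp_mon_log h0, Circle.smul_def, smul_eq_mul,
      V.eq_coord_mul h0 j, coe_prod_zpow]
    push_cast
    rw [mul_left_comm, ← Finset.prod_mul_distrib]
    congr 1
    refine Finset.prod_congr rfl fun i _ => ?_
    rw [← mul_zpow, hθ]

theorem zero_mem_domain : (0 : Model G) ∈ V.domain := by
  refine ⟨fun i => Real.log (V.l i) / 2, funext fun i => ?_⟩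
  simp [eqn, mul_div_cancel₀, Real.exp_log (V.l_pos i)]

open Classical in
/-- The lift to the level set, with junk values outside of the domain. -/
def point (w : Model G) : level G lam :=
  if hw : w ∈ V.domain then ⟨V.lift w, V.lift_mem_level hw⟩
  else ⟨V.lift 0, V.lift_mem_level V.zero_mem_domain⟩

theorem point_coe {w : Model G} (hw : w ∈ V.domain) : (V.point w : Fin n → ℂ) = V.lift w := by
  simp [point, hw]

/-- The inverse of the toric chart. -/
def param (w : Model G) : ReducedSpace G lam := proj G lam (V.point w)

theorem param_coord {z : level G lam} (h0 : ∀ i, (z : Fin n → ℂ) (V.s i) ≠ 0) :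
    V.param (V.coord z) = proj G lam z := by
  obtain ⟨g, hg, h⟩ := V.exists_smul_lift_coord z.2 h0
  refine Eq.symm (proj_eq_iff.2 ⟨g, hg, ?_⟩)
  rw [V.point_coe (V.coord_mem_domain z.2 h0), h]

theorem contDiffAt_lift {w : Model G} (hw : w ∈ V.domain) : ContDiffAt ℝ ∞ V.lift w := by
  have h1 := V.contDiffAt_sol hw
  have h2 : ∀ x : ℝ → ℝ, ContDiff ℝ ∞ x → ContDiff ℝ ∞ fun y => (x y : ℂ) :=
    fun x hx => Complex.ofRealCLM.contDiff.comp hx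
  have h3 := h2 _ Real.contDiff_exp
  rw [contDiffAt_pi]
  intro l
  obtain ⟨i | j, rfl⟩ := V.e.surjective l
  · simp only [V.lift_s]
    exact h3.contDiffAt.comp w (contDiffAt_pi.1 h1 i)
  · simp only [V.lift_t]
    refine ContDiffAt.mul (by fun_prop) (h3.contDiffAt.comp w ?_)
    exact (contDiffAt_pi.1 V.contDiff_mon.contDiffAt j).comp w h1

theorem continuousOn_point : ContinuousOn V.point V.domain := by
  intro w hw
  rw [ContinuousWithinAt, tendsto_subtype_rng, V.point_coe hw]
  refine ((V.contDiffAt_lift hw).continuousAt.continuousWithinAt (s := V.domain)).congr'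
    ?_
  filter_upwards [self_mem_nhdsWithin] with x hx using (V.point_coe hx).symm

theorem continuousAt_point {w : Model G} (hw : w ∈ V.domain) : ContinuousAt V.point w :=
  V.continuousOn_point.continuousAt (V.isOpen_domain.mem_nhds hw)

end Vertex

end ToricReduction

end
noncomputable section

namespace ToricReduction

variable {n : ℕ} {G : Subgroup (Fin n → Circle)} {lam : lieAlg G →L[ℝ] ℝ}

/-! ### Tangent vectors of the level set -/

theorem hasDerivAt_prod_zpow {ι : Type*} [Fintype ι] {f : ι → ℂ → ℂ} {f' : ι → ℂ} (m : ι → ℤ)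
    {x : ℂ} (hf : ∀ i, HasDerivAt (f i) (f' i) x) (h0 : ∀ i, f i x ≠ 0) :
    HasDerivAt (fun y => ∏ i, f i y ^ m i)
      ((∏ i, f i x ^ m i) * ∑ i, (m i : ℂ) * f' i / f i x) x := by
  classical
  induction (Finset.univ : Finset ι) using Finset.induction_on with
  | empty => simpa using hasDerivAt_const x (1 : ℂ)
  | insert i s hi ih =>
    simp only [Finset.prod_insert hi, Finset.sum_insert hi]
    refine (((hasDerivAt_zpow (m i) (f i x) (Or.inl (h0 i))).comp x (hf i)).mul ih).congr_deriv ?_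
    simp only [Function.comp_apply]
    rw [zpow_sub_one₀ (h0 i)]
    ring

theorem mem_levelTangent_of_hasDerivAt {γ : ℝ → Fin n → ℂ} {v : Fin n → ℂ}
    (hγ : HasDerivAt γ v 0) (h : ∀ᶠ x in 𝓝 0, γ x ∈ level G lam) :
    v ∈ levelTangent G (γ 0) := by
  rw [mem_levelTangent_iff]
  intro ξ hξ
  have h1 : HasDerivAt (fun x => ∑ l, ‖γ x l‖ ^ 2 * ξ l)
      (∑ l, 2 * ((starRingEnd ℂ) (γ 0 l) * v l).re * ξ l) 0 :=
    HasDerivAt.fun_sum fun l _ =>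
      (Vertex.hasDerivAt_norm_sq (hasDerivAt_pi.1 hγ l)).mul_const (ξ l)
  have h2 : HasDerivAt (fun x => ∑ l, ‖γ x l‖ ^ 2 * ξ l) 0 0 := by
    refine (hasDerivAt_const (0 : ℝ) (lam ⟨ξ, hξ⟩)).congr_of_eventuallyEq ?_
    filter_upwards [h] with x hx using mem_level_iff.1 hx ⟨ξ, hξ⟩
  have h3 := h1.unique h2
  simp only [mul_assoc, ← Finset.mul_sum] at h3
  simpa using h3

theorem IsLocalExtension.eventually_eq_proj [ChartedSpace (Model G) (ReducedSpace G lam)]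
    {z : level G lam} {P : (Fin n → ℂ) → ReducedSpace G lam} (h : IsLocalExtension G lam z P) :
    ∀ᶠ y in 𝓝 (z : Fin n → ℂ), ∀ hy : y ∈ level G lam, P y = proj G lam ⟨y, hy⟩ := by
  have := h.2
  rw [nhds_subtype_eq_comap, Filter.eventually_comap] at this
  filter_upwards [this] with y hy hy' using hy ⟨y, hy'⟩ rfl

namespace Vertex

variable (V : Vertex G lam)

theorem analyticAt_coord {z : Fin n → ℂ} (h0 : ∀ i, z (V.s i) ≠ 0) :
    AnalyticAt ℂ V.coord z := by
  have hp : ∀ l, AnalyticAt ℂ (fun y : Fin n → ℂ => y l) z := fun l =>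
    (ContinuousLinearMap.proj (R := ℂ) (φ := fun _ : Fin n => ℂ) l).analyticAt z
  rw [analyticAt_pi_iff]
  intro j
  exact (hp _).mul (Finset.analyticAt_fun_prod _ fun i _ => (hp _).zpow (h0 i))

theorem contDiffAt_coord {z : Fin n → ℂ} (h0 : ∀ i, z (V.s i) ≠ 0) :
    ContDiffAt ℂ ω V.coord z := (V.analyticAt_coord h0).contDiffAt

/-- The differential of the chart. -/
def dcoord (z : Fin n → ℂ) : (Fin n → ℂ) →L[ℂ] Model G := fderiv ℂ V.coord z

theorem hasFDerivAt_coord {z : Fin n → ℂ} (h0 : ∀ i, z (V.s i) ≠ 0) :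
    HasFDerivAt V.coord (V.dcoord z) z :=
  (V.analyticAt_coord h0).differentiableAt.hasFDerivAt

theorem hasFDerivAt_coord_real {z : Fin n → ℂ} (h0 : ∀ i, z (V.s i) ≠ 0) :
    HasFDerivAt V.coord ((V.dcoord z).restrictScalars ℝ) z :=
  (V.hasFDerivAt_coord h0).restrictScalars ℝ

theorem dcoord_apply {z : Fin n → ℂ} (h0 : ∀ i, z (V.s i) ≠ 0) (v : Fin n → ℂ) (j) :
    V.dcoord z v j = (∏ i, z (V.s i) ^ (-V.a i j)) *
      (v (V.t j) - z (V.t j) * ∑ i, (V.a i j : ℂ) * v (V.s i) / z (V.s i)) := by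
  have hγ : HasDerivAt (fun y : ℂ => z + y • v) v 0 := by
    simpa using ((hasDerivAt_id (0 : ℂ)).smul_const v).const_add z
  have h1 := (V.hasFDerivAt_coord h0).comp_hasDerivAt_of_eq (0 : ℂ) hγ (by simp)
  have h2 := hasDerivAt_pi.1 h1 j
  have h3 := (hasDerivAt_pi.1 hγ (V.t j)).mul (hasDerivAt_prod_zpow (fun i => -V.a i j)
    (fun i => hasDerivAt_pi.1 hγ (V.s i)) (by simpa using h0))
  have h4 := h2.unique h3
  rw [h4]
  simp only [zero_smul, add_zero, Int.cast_neg, neg_mul, neg_div, Finset.sum_neg_distrib]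
  ring

theorem dcoord_smul {z : Fin n → ℂ} (h0 : ∀ i, z (V.s i) ≠ 0) {g : Fin n → Circle} (hg : g ∈ G)
    (v : Fin n → ℂ) : V.dcoord (g • z) (g • v) = V.dcoord z v := by
  have h0' : ∀ i, (g • z) (V.s i) ≠ 0 := fun i => by
    simp [Pi.smul_apply', Circle.smul_def, h0 i]
  have hγ : ∀ z v : Fin n → ℂ, HasDerivAt (fun y : ℂ => z + y • v) v 0 := fun z v => by
    simpa using ((hasDerivAt_id (0 : ℂ)).smul_const v).const_add z
  have h1 := (V.hasFDerivAt_coord h0).comp_hasDerivAt_of_eq (0 : ℂ) (hγ z v) (by simp)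
  have h2 := (V.hasFDerivAt_coord h0').comp_hasDerivAt_of_eq (0 : ℂ) (hγ (g • z) (g • v)) (by simp)
  refine h2.unique (h1.congr_of_eventuallyEq (Filter.Eventually.of_forall fun y => ?_))
  simp only [Function.comp_apply]
  rw [← V.coord_smul hg (z + y • v)]
  congr 1
  funext l
  simp [Pi.smul_apply', Circle.smul_def]
  ring

/-- The kernel of the chart differential consists of the vectors (X + iY)z with X, Y in 𝔤. Testing
tangency against X gives ∑ |z_l|² X_l² = 0, so X vanishes on the coordinates that determine it. -/
theorem eq_orbitVec_of_dcoord_eq_zero {z v : Fin n → ℂ} (h0 : ∀ i, z (V.s i) ≠ 0)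
    (hv : v ∈ levelTangent G z) (h : V.dcoord z v = 0) :
    ∃ ξ ∈ lieAlg G, v = orbitVec ξ z := by
  set β : Fin (Module.finrank ℝ (lieAlg G)) → ℂ := fun i => v (V.s i) / z (V.s i) with hβ
  set X := V.glue (fun i => (β i).re) (V.mon fun i => (β i).re) with hX
  set Y := V.glue (fun i => (β i).im) (V.mon fun i => (β i).im) with hY
  have hvl : ∀ l, v l = (X l + Complex.I * Y l) * z l := by
    intro l
    obtain ⟨i | j, rfl⟩ := V.e.surjective l
    · rw [hX, hY, glue_s, glue_s, mul_comm Complex.I, Complex.re_add_im, hβ,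
        div_mul_cancel₀ _ (h0 i)]
    · have h1 := congrFun h j
      rw [V.dcoord_apply h0, Pi.zero_apply, mul_eq_zero] at h1
      have h2 := sub_eq_zero.1 (h1.resolve_left
        (Finset.prod_ne_zero_iff.2 fun i _ => zpow_ne_zero _ (h0 i)))
      rw [h2, hX, hY, glue_t, glue_t, mul_comm]
      congr 1
      simp only [mon]
      push_cast
      rw [Finset.mul_sum, ← Finset.sum_add_distrib]
      refine Finset.sum_congr rfl fun i _ => ?_
      rw [mul_div_assoc]
      conv_lhs => rw [← Complex.re_add_im (v (V.s i) / z (V.s i))]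
      ring
  have h1 := ToricReduction.mem_levelTangent_iff.1 hv X (V.glue_mon_mem _)
  have h2 : ∀ l, ((starRingEnd ℂ) (z l) * v l).re * X l = ‖z l‖ ^ 2 * X l ^ 2 := fun l => by
    rw [hvl, ← Complex.normSq_eq_norm_sq, Complex.normSq_apply]
    simp
    ring
  simp only [h2] at h1
  rw [Finset.sum_eq_zero_iff_of_nonneg fun _ _ => by positivity] at h1
  have hβ0 : ∀ i, (β i).re = 0 := fun i => by
    have := h1 (V.s i) (Finset.mem_univ _)
    simpa [hX, h0 i] using this
  refine ⟨Y, V.glue_mon_mem _, funext fun l => ?_⟩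
  have hX0 : X l = 0 := by
    obtain ⟨i | j, rfl⟩ := V.e.surjective l
    · simp [hX, hβ0]
    · simp [hX, mon, hβ0]
  rw [hvl, hX0, orbitVec]
  simp

/-- `H` solves the complexified tangency equations with prescribed coordinates u on `V.t`. Its
composite with `dcoord` is an injective endomorphism, hence onto. -/
theorem exists_horizontal {z : Fin n → ℂ} (h0 : ∀ i, z (V.s i) ≠ 0) (u : Model G) :
    ∃ v ∈ horizontal G z, V.dcoord z v = u := by
  let H : Model G →ₗ[ℂ] (Fin n → ℂ) :=
    { toFun := fun u => V.glue (fun i => -(∑ j, (V.a i j : ℂ) *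
        ((starRingEnd ℂ) (z (V.t j)) * u j)) / (starRingEnd ℂ) (z (V.s i))) u
      map_add' := fun x y => V.funext_coords (fun i => by
        simp [mul_add, Finset.sum_add_distrib, add_div, neg_div]; ring) (fun j => by simp)
      map_smul' := fun c x => V.funext_coords (fun i => by
        simp only [Pi.smul_apply, smul_eq_mul, glue_s, RingHom.id_apply, mul_neg, mul_div_assoc',
          Finset.mul_sum]
        congr 2
        exact Finset.sum_congr rfl fun j _ => by ring) (fun j => by simp) }
  have hHT : ∀ u, H u ∈ levelTangent G z := fun u => by
    rw [V.mem_levelTangent_iff]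
    intro i
    have h1 : (starRingEnd ℂ) (z (V.s i)) * H u (V.s i) +
        ∑ j, (V.a i j : ℂ) * ((starRingEnd ℂ) (z (V.t j)) * H u (V.t j)) = 0 := by
      have : (starRingEnd ℂ) (z (V.s i)) ≠ 0 := by simpa using h0 i
      simp only [H, LinearMap.coe_mk, AddHom.coe_mk, glue_s, glue_t]
      rw [mul_div_cancel₀ _ this]
      ring
    have h2 := congrArg Complex.re h1
    rw [Complex.add_re, Complex.re_sum] at h2
    rw [← Complex.zero_re, ← h2]
    congr 1
    refine Finset.sum_congr rfl fun j _ => ?_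
    rw [← Complex.ofReal_intCast, Complex.re_ofReal_mul]
  have hH : ∀ u, H u ∈ horizontal G z := fun u =>
    ⟨hHT u, by rw [← map_smul]; exact hHT _⟩
  -- A kernel vector is both horizontal and an orbit direction, and these are orthogonal.
  have hinj : Function.Injective ((V.dcoord z).toLinearMap.comp H) := by
    rw [injective_iff_map_eq_zero]
    intro u hu
    obtain ⟨ξ, hξ, h1⟩ := V.eq_orbitVec_of_dcoord_eq_zero h0 (hHT u) hu
    have h2 := ToricReduction.mem_levelTangent_iff.1 (hH u).2 ξ hξ
    rw [h1] at h2
    have h3 : ∀ l, ((starRingEnd ℂ) (z l) * (Complex.I • orbitVec ξ z) l).re * ξ l =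
        -(‖z l‖ ^ 2 * ξ l ^ 2) := fun l => by
      rw [← Complex.normSq_eq_norm_sq, Complex.normSq_apply]
      simp [orbitVec]
      ring
    simp only [h3, Finset.sum_neg_distrib, neg_eq_zero] at h2
    rw [Finset.sum_eq_zero_iff_of_nonneg fun _ _ => by positivity] at h2
    have h4 : ∀ l, H u l = 0 := fun l => by
      rw [h1, orbitVec]
      have := h2 l (Finset.mem_univ _)
      rcases mul_eq_zero.1 this with h | h
      · rw [pow_eq_zero_iff two_ne_zero, norm_eq_zero] at h
        simp [h]
      · rw [pow_eq_zero_iff two_ne_zero] at h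
        simp [h]
    funext j
    have := h4 (V.t j)
    simpa [H] using this
  obtain ⟨x, hx⟩ := LinearMap.injective_iff_surjective.1 hinj u
  exact ⟨H x, hH x, hx⟩

/-- The straight line through z is pushed back to the level set by rescaling the coordinates in
`V.s`, which enter the equations through one squared modulus each. -/
theorem exists_curve {z v : Fin n → ℂ} (hz : z ∈ level G lam) (h0 : ∀ i, z (V.s i) ≠ 0)
    (hv : v ∈ levelTangent G z) : ∃ γ : ℝ → Fin n → ℂ, γ 0 = z ∧ HasDerivAt γ v 0 ∧
      ∀ᶠ x in 𝓝 0, γ x ∈ level G lam := by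
  set c : ℝ → Fin n → ℂ := fun x => z + (x : ℂ) • v with hc
  have hc0 : c 0 = z := by simp [hc]
  have hcd : HasDerivAt c v 0 := by
    have := ((Complex.ofRealCLM.hasDerivAt (x := 0)).smul_const v).const_add z
    rw [Complex.ofRealCLM_apply, Complex.ofReal_one, one_smul] at this
    exact this
  have hN : ∀ l, HasDerivAt (fun x => ‖c x l‖ ^ 2)
      (2 * ((starRingEnd ℂ) (z l) * v l).re) 0 := fun l => by
    have := Vertex.hasDerivAt_norm_sq (hasDerivAt_pi.1 hcd l)
    rwa [hc0] at this
  set N : Fin (Module.finrank ℝ (lieAlg G)) → ℝ → ℝ := fun i x =>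
    V.l i - ∑ j, (V.a i j : ℝ) * ‖c x (V.t j)‖ ^ 2 with hNdef
  have hlev := V.mem_level_iff.1 hz
  have htan := V.mem_levelTangent_iff.1 hv
  have hN0 : ∀ i, N i 0 = ‖c 0 (V.s i)‖ ^ 2 := fun i => by
    simp only [hNdef, hc0]
    linarith [hlev i]
  have hpos : ∀ i, 0 < ‖c 0 (V.s i)‖ ^ 2 := fun i => by
    rw [hc0]
    exact pow_pos (norm_pos_iff.2 (h0 i)) 2
  have hNd : ∀ i, HasDerivAt (N i) (2 * ((starRingEnd ℂ) (z (V.s i)) * v (V.s i)).re) 0 :=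
    fun i => by
      refine ((HasDerivAt.fun_sum fun j _ =>
        (hN (V.t j)).const_mul (V.a i j : ℝ)).const_sub (V.l i)).congr_deriv ?_
      rw [eq_neg_of_add_eq_zero_left (htan i), mul_neg, Finset.mul_sum]
      congr 1
      exact Finset.sum_congr rfl fun j _ => by ring
  set r : Fin (Module.finrank ℝ (lieAlg G)) → ℝ → ℝ := fun i x =>
    Real.sqrt (N i x / ‖c x (V.s i)‖ ^ 2) with hr
  have hr0 : ∀ i, r i 0 = 1 := fun i => by
    rw [hr]
    simp only
    rw [hN0, div_self (hpos i).ne', Real.sqrt_one]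
  -- Tangency of v makes the required and the actual squared modulus agree to first order, so the
  -- rescaling does not change the velocity.
  have hrd : ∀ i, HasDerivAt (r i) 0 0 := fun i => by
    refine (((hNd i).div (hN (V.s i)) (hpos i).ne').sqrt ?_).congr_deriv ?_
    · rw [Pi.div_apply, hN0, div_self (hpos i).ne']
      exact one_ne_zero
    · rw [hN0]
      ring
  refine ⟨fun x => V.glue (fun i => (r i x : ℂ) * c x (V.s i)) fun j => c x (V.t j),
    V.funext_coords (fun i => ?_) (fun j => ?_), ?_, ?_⟩
  · simp [hr0, hc0]
  · simp [hc0]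
  · rw [hasDerivAt_pi]
    intro l
    obtain ⟨i | j, rfl⟩ := V.e.surjective l
    · simp only [glue_s]
      refine ((hrd i).ofReal_comp.mul (hasDerivAt_pi.1 hcd (V.s i))).congr_deriv ?_
      simp [hr0]
    · simp only [glue_t]
      exact hasDerivAt_pi.1 hcd (V.t j)
  · have h1 : ∀ i, ∀ᶠ x in 𝓝 0, 0 < N i x := fun i =>
      (hNd i).continuousAt.eventually_const_lt (by rw [hN0]; exact hpos i)
    have h2 : ∀ i, ∀ᶠ x in 𝓝 0, 0 < ‖c x (V.s i)‖ ^ 2 := fun i =>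
      (hN (V.s i)).continuousAt.eventually_const_lt (hpos i)
    filter_upwards [Filter.eventually_all.2 h1, Filter.eventually_all.2 h2] with x hx1 hx2
    rw [V.mem_level_iff]
    intro i
    rw [glue_s, norm_mul, mul_pow, Complex.norm_real, Real.norm_eq_abs, sq_abs, hr,
      Real.sq_sqrt (div_nonneg (hx1 i).le (hx2 i).le), div_mul_cancel₀ _ (hx2 i).ne', hNdef]
    simp

/-- The differential of the lift. -/
def dlift (w : Model G) : Model G →L[ℝ] (Fin n → ℂ) := fderiv ℝ V.lift w

theorem hasFDerivAt_lift {w : Model G} (hw : w ∈ V.domain) :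
    HasFDerivAt V.lift (V.dlift w) w :=
  ((V.contDiffAt_lift hw).differentiableAt (by simp)).hasFDerivAt

theorem hasDerivAt_line (w u : Model G) : HasDerivAt (fun x : ℝ => w + x • u) u 0 := by
  simpa using ((hasDerivAt_id (0 : ℝ)).smul_const u).const_add w

theorem dlift_mem {w : Model G} (hw : w ∈ V.domain) (u : Model G) :
    V.dlift w u ∈ levelTangent G (V.lift w) := by
  have h1 := (V.hasFDerivAt_lift hw).comp_hasDerivAt_of_eq (0 : ℝ) (hasDerivAt_line w u) (by simp)
  have h2 := mem_levelTangent_of_hasDerivAt (G := G) (lam := lam) h1 ?_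
  · simpa using h2
  · have : ∀ᶠ x in 𝓝 (0 : ℝ), w + x • u ∈ V.domain :=
      (hasDerivAt_line w u).continuousAt.eventually_mem
        (V.isOpen_domain.mem_nhds (by simpa using hw))
    filter_upwards [this] with x hx using V.lift_mem_level hx

theorem dcoord_dlift {w : Model G} (hw : w ∈ V.domain) (u : Model G) :
    V.dcoord (V.lift w) (V.dlift w u) = u := by
  have h1 := (V.hasFDerivAt_coord_real (V.lift_s_ne_zero w)).comp w (V.hasFDerivAt_lift hw)
  have h2 : V.coord ∘ V.lift = id := funext V.coord_lift
  rw [h2] at h1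
  exact congrArg (fun f : Model G →L[ℝ] Model G => f u) (h1.unique (hasFDerivAt_id w))

/-- Rotate z to the lift by an element of `G`. A rotated tangent vector and the lift of its image
have the same chart differential, so they differ by an orbit direction, which the standard form
ignores. -/
theorem stdForm_eq_stdForm_dlift {z v v' : Fin n → ℂ} (hz : z ∈ level G lam)
    (h0 : ∀ i, z (V.s i) ≠ 0) (hv : v ∈ levelTangent G z) (hv' : v' ∈ levelTangent G z) :
    stdForm v v' = stdForm (V.dlift (V.coord z) (V.dcoord z v))
      (V.dlift (V.coord z) (V.dcoord z v')) := by
  obtain ⟨g, hg, hgz⟩ := V.exists_smul_lift_coord hz h0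
  have hw := V.coord_mem_domain hz h0
  set w := V.coord z
  have key : ∀ v ∈ levelTangent G z, ∃ ξ ∈ lieAlg G,
      g⁻¹ • v = V.dlift w (V.dcoord z v) + orbitVec ξ (V.lift w) := fun v hv => by
    have h1 : g⁻¹ • v ∈ levelTangent G (V.lift w) := by
      have := smul_mem_levelTangent (g := g⁻¹) hv
      rwa [← hgz, inv_smul_smul] at this
    have h2 : V.dcoord z v = V.dcoord (V.lift w) (g⁻¹ • v) := by
      rw [← V.dcoord_smul (V.lift_s_ne_zero w) hg, hgz, smul_inv_smul]
    obtain ⟨ξ, hξ, h3⟩ := V.eq_orbitVec_of_dcoord_eq_zero (V.lift_s_ne_zero w)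
      (levelTangent_sub h1 (V.dlift_mem hw (V.dcoord z v)))
      (by rw [map_sub, V.dcoord_dlift hw, h2, sub_self])
    exact ⟨ξ, hξ, by rw [← h3]; abel⟩
  obtain ⟨ξ, hξ, h1⟩ := key v hv
  obtain ⟨ξ', hξ', h2⟩ := key v' hv'
  have hT' : g⁻¹ • v' ∈ levelTangent G (V.lift w) := by
    have := smul_mem_levelTangent (g := g⁻¹) hv'
    rwa [← hgz, inv_smul_smul] at this
  rw [← stdForm_smul g⁻¹, h1, stdForm_add_left, stdForm_orbitVec_left hξ hT', add_zero, h2,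
    stdForm_add_right, stdForm_swap (orbitVec ξ' _),
    stdForm_orbitVec_left hξ' (V.dlift_mem hw _), neg_zero, add_zero]

/-- Both extensions agree with the projection along a curve in the level set with velocity v. -/
theorem differential_eq [ChartedSpace (Model G) (ReducedSpace G lam)] {z : level G lam}
    (h0 : ∀ i, (z : Fin n → ℂ) (V.s i) ≠ 0) {P P' : (Fin n → ℂ) → ReducedSpace G lam}
    (hP : IsLocalExtension G lam z P) (hP' : IsLocalExtension G lam z P') {v : Fin n → ℂ}
    (hv : v ∈ levelTangent G (z : Fin n → ℂ)) : differential P z v = differential P' z v := by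
  obtain ⟨γ, hγ0, hγ, hγl⟩ := V.exists_curve z.2 h0 hv
  have h1 := hP.hasFDerivAt.comp_hasDerivAt_of_eq (0 : ℝ) hγ hγ0.symm
  have h2 := hP'.hasFDerivAt.comp_hasDerivAt_of_eq (0 : ℝ) hγ hγ0.symm
  refine h1.unique (h2.congr_of_eventuallyEq ?_)
  have hc := hγ.continuousAt
  rw [ContinuousAt, hγ0] at hc
  filter_upwards [hc.eventually hP.eventually_eq_proj, hc.eventually hP'.eventually_eq_proj,
    hγl] with x hx1 hx2 hx3
  simp only [Function.comp_apply, hx1 hx3, hx2 hx3]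

end Vertex

end ToricReduction

end
noncomputable section

namespace ToricReduction

variable {n : ℕ} {G : Subgroup (Fin n → Circle)} {lam : lieAlg G →L[ℝ] ℝ}

/-! ### The complex structure of the reduced space -/

theorem proj_mem_image_iff {ι : Type*} (s : ι → Fin n) (z : level G lam) :
    proj G lam z ∈ proj G lam '' {y | ∀ i, (y : Fin n → ℂ) (s i) ≠ 0} ↔
      ∀ i, (z : Fin n → ℂ) (s i) ≠ 0 := by
  refine ⟨?_, fun h => ⟨z, h, rfl⟩⟩
  rintro ⟨y, hy, h⟩ i hi
  obtain ⟨g, -, hg⟩ := proj_eq_iff.1 h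
  refine hy i ?_
  rw [← hg, Pi.smul_apply', hi, smul_zero]

theorem isOpen_image_proj {ι : Type*} [Finite ι] (s : ι → Fin n) :
    IsOpen (proj G lam '' {y | ∀ i, (y : Fin n → ℂ) (s i) ≠ 0}) := by
  rw [isOpen_iff_preimage_proj]
  have : proj G lam ⁻¹' (proj G lam '' {y | ∀ i, (y : Fin n → ℂ) (s i) ≠ 0}) =
      ⋂ i, {y : level G lam | (y : Fin n → ℂ) (s i) ≠ 0} := by
    ext z
    rw [Set.mem_preimage, proj_mem_image_iff, Set.mem_iInter]
    rfl
  rw [this]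
  exact isOpen_iInter_of_finite fun i =>
    isOpen_ne_fun ((continuous_apply _).comp continuous_subtype_val) continuous_const

theorem isOpen_openPart : IsOpen (openPart G lam) := isOpen_image_proj id

namespace Vertex

variable (V : Vertex G lam)

/-- The domain of the toric chart at a vertex. -/
def source : Set (ReducedSpace G lam) :=
  proj G lam '' {y | ∀ i, (y : Fin n → ℂ) (V.s i) ≠ 0}

theorem proj_mem_source_iff (z : level G lam) :
    proj G lam z ∈ V.source ↔ ∀ i, (z : Fin n → ℂ) (V.s i) ≠ 0 := proj_mem_image_iff _ z

theorem param_mem_source {w : Model G} (hw : w ∈ V.domain) : V.param w ∈ V.source := by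
  rw [param, proj_mem_source_iff, V.point_coe hw]
  exact V.lift_s_ne_zero w

/-- The toric coordinates on the reduced space. -/
def quotCoord : ReducedSpace G lam → Model G :=
  Quotient.lift (fun z : level G lam => V.coord z) (by
    rintro x y ⟨g, hg⟩
    have h : (g : Fin n → Circle) • (y : Fin n → ℂ) = x := hg
    rw [← h, V.coord_smul g.2])

theorem quotCoord_proj (z : level G lam) : V.quotCoord (proj G lam z) = V.coord z := rfl

theorem quotCoord_param {w : Model G} (hw : w ∈ V.domain) : V.quotCoord (V.param w) = w := by
  rw [param, quotCoord_proj, V.point_coe hw, V.coord_lift]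

theorem continuousAt_param {w : Model G} (hw : w ∈ V.domain) : ContinuousAt V.param w :=
  continuous_proj.continuousAt.comp (V.continuousAt_point hw)

/-- The toric chart at a vertex. -/
def chart : OpenPartialHomeomorph (ReducedSpace G lam) (Model G) where
  toFun := V.quotCoord
  invFun := V.param
  source := V.source
  target := V.domain
  map_source' := by
    rintro _ ⟨z, hz, rfl⟩
    exact V.coord_mem_domain z.2 hz
  map_target' := fun _ hw => V.param_mem_source hw
  left_inv' := by
    rintro _ ⟨z, hz, rfl⟩
    exact V.param_coord hz
  right_inv' := fun _ hw => V.quotCoord_param hw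
  open_source := isOpen_image_proj _
  open_target := V.isOpen_domain
  continuousOn_toFun := by
    rw [continuousOn_open_iff (show IsOpen V.source from isOpen_image_proj _)]
    intro t ht
    rw [isOpen_iff_preimage_proj, Set.preimage_inter]
    have h1 : IsOpen (proj G lam ⁻¹' V.source) :=
      (isOpen_image_proj V.s).preimage continuous_proj
    have h2 : ContinuousOn (fun z : level G lam => V.coord z) (proj G lam ⁻¹' V.source) :=
      fun z hz => ((V.analyticAt_coord ((V.proj_mem_source_iff z).1 hz)).continuousAt.comp
        continuous_subtype_val.continuousAt).continuousWithinAt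
    exact (continuousOn_open_iff h1).1 h2 t ht
  continuousOn_invFun := fun _ hw => (V.continuousAt_param hw).continuousWithinAt

theorem contDiff_glue_one : ContDiff ℂ ω fun w : Model G => V.glue (fun _ => (1 : ℂ)) w := by
  rw [contDiff_pi]
  intro l
  obtain ⟨i | j, rfl⟩ := V.e.surjective l
  · simp only [glue_s]
    exact contDiff_const
  · simp only [glue_t]
    exact contDiff_apply ℂ ℂ j

/-- By `lift_eq`, the second chart takes the same value on the lift as on (1, w), so the
nonholomorphic `sol` disappears and a Laurent monomial map is left. -/
theorem contDiffOn_transition (V' : Vertex G lam) :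
    ContDiffOn ℂ ω (V'.quotCoord ∘ V.param) (V.domain ∩ V.param ⁻¹' V'.source) := by
  have h1 : ∀ w ∈ V.domain ∩ V.param ⁻¹' V'.source,
      (V'.quotCoord ∘ V.param) w = V'.coord (V.glue (fun _ => (1 : ℂ)) w) := fun w hw => by
    rw [Function.comp_apply, param, quotCoord_proj, V.point_coe hw.1, lift_eq,
      V'.coord_exp_mul (V.glue_mon_mem _)]
  refine ContDiffOn.congr (fun w hw => ?_) h1
  have h2 : ∀ i, V.glue (fun _ => (1 : ℂ)) w (V'.s i) ≠ 0 := fun i hi => by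
    have := (V'.proj_mem_source_iff _).1 hw.2 i
    rw [V.point_coe hw.1, lift_eq] at this
    exact this (by simp only [hi, mul_zero])
  exact ((V'.contDiffAt_coord h2).comp w V.contDiff_glue_one.contDiffAt).contDiffWithinAt

theorem isLocalExtension_param_coord [ChartedSpace (Model G) (ReducedSpace G lam)]
    {z : level G lam} (h0 : ∀ i, (z : Fin n → ℂ) (V.s i) ≠ 0)
    (h : ContMDiffAt 𝓘(ℝ, Model G) 𝓘(ℝ, Model G) ∞ V.param (V.coord z)) :
    IsLocalExtension G lam z (V.param ∘ V.coord) := by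
  refine ⟨?_, ?_⟩
  · have h1 : ContDiffAt ℝ ∞ V.coord (z : Fin n → ℂ) :=
      ((V.contDiffAt_coord h0).restrict_scalars ℝ).of_le le_top
    exact ContMDiffAt.comp (z : Fin n → ℂ) h h1.contMDiffAt
  · have h1 : ∀ i, ∀ᶠ y : level G lam in 𝓝 z, (y : Fin n → ℂ) (V.s i) ≠ 0 := fun i =>
      (isOpen_ne_fun ((continuous_apply _).comp continuous_subtype_val)
        continuous_const).mem_nhds (h0 i)
    filter_upwards [Filter.eventually_all.2 h1] with y hy using V.param_coord hy

end Vertex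

/-- In a toric chart, `U` contains the points all of whose coordinates w_j are nonzero. -/
theorem dense_openPart (hV : ∀ z ∈ level G lam, ∃ V : Vertex G lam, ∀ i, z (V.s i) ≠ 0) :
    Dense (openPart G lam) := by
  intro x
  obtain ⟨z, rfl⟩ := proj_surjective x
  obtain ⟨V, h0⟩ := hV z z.2
  have hw := V.coord_mem_domain z.2 h0
  have hd : Dense {w : Model G | ∀ j, w j ≠ 0} := by
    have := dense_pi (s := fun _ : Fin (n - Module.finrank ℝ (lieAlg G)) => ({0}ᶜ : Set ℂ))
      Set.univ fun j _ => dense_compl_singleton (0 : ℂ)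
    convert this using 1
    ext w
    simp [Set.mem_pi]
  have h1 := mem_closure_image (V.continuousAt_param hw)
    (hd.open_subset_closure_inter V.isOpen_domain hw)
  rw [V.param_coord h0] at h1
  refine closure_mono ?_ h1
  rintro _ ⟨w, ⟨hw, hw0⟩, rfl⟩
  refine ⟨V.point w, fun l => ?_, rfl⟩
  rw [V.point_coe hw]
  obtain ⟨i | j, rfl⟩ := V.e.surjective l
  · exact V.lift_s_ne_zero w i
  · rw [V.lift_t]
    exact mul_ne_zero (hw0 j) (by exact_mod_cast (Real.exp_pos _).ne')

open Classical in
/-- The atlas of toric charts. -/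
@[reducible] def toricChartedSpace
    (hV : ∀ z ∈ level G lam, ∃ V : Vertex G lam, ∀ i, z (V.s i) ≠ 0) :
    ChartedSpace (Model G) (ReducedSpace G lam) where
  atlas := Set.range Vertex.chart
  chartAt x := (Classical.choose (hV x.out x.out.2)).chart
  mem_chart_source x := by
    have := (Vertex.proj_mem_source_iff _ x.out).2 (Classical.choose_spec (hV x.out x.out.2))
    rwa [proj, Quotient.out_eq] at this
  chart_mem_atlas x := Set.mem_range_self _

theorem isReducedComplexStructure_toric
    (hV : ∀ z ∈ level G lam, ∃ V : Vertex G lam, ∀ i, z (V.s i) ≠ 0) :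
    IsReducedComplexStructure (cs := toricChartedSpace hV) G lam := by
  let _ := toricChartedSpace hV
  have hchart : ∀ z : level G lam, ∃ V : Vertex G lam,
      chartAt (Model G) (proj G lam z) = V.chart ∧ ∀ i, (z : Fin n → ℂ) (V.s i) ≠ 0 := fun z => by
    refine ⟨_, rfl, ?_⟩
    rw [← Vertex.proj_mem_source_iff]
    exact mem_chart_source (Model G) (proj G lam z)
  have hparam : ∀ (z : level G lam) (V : Vertex G lam),
      chartAt (Model G) (proj G lam z) = V.chart → (∀ i, (z : Fin n → ℂ) (V.s i) ≠ 0) →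
      IsLocalExtension G lam z (V.param ∘ V.coord) := fun z V hz h0 => by
    refine V.isLocalExtension_param_coord h0 (contMDiffAt_iff.2
      ⟨V.continuousAt_param (V.coord_mem_domain z.2 h0), ?_⟩)
    rw [V.param_coord h0]
    simp only [mfld_simps, contDiffWithinAt_univ, hz]
    refine contDiffAt_id.congr_of_eventuallyEq ?_
    filter_upwards [V.isOpen_domain.mem_nhds (V.coord_mem_domain z.2 h0)] with w hw
    exact V.quotCoord_param hw
  -- In toric charts the projection is given by `coord`, so its differential is the complex linear
  -- `dcoord`; the remaining axioms follow from this.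
  have hdiff : ∀ (z : level G lam) (V : Vertex G lam),
      chartAt (Model G) (proj G lam z) = V.chart → (∀ i, (z : Fin n → ℂ) (V.s i) ≠ 0) →
      ∀ P, IsLocalExtension G lam z P → ∀ v ∈ levelTangent G (z : Fin n → ℂ),
        differential P z v = V.dcoord z v := fun z V hz h0 P hP v hv => by
    rw [V.differential_eq h0 hP (hparam z V hz h0) hv]
    have h1 := (hparam z V hz h0).hasFDerivAt
    rw [hz] at h1
    have h2 := h1.unique ((V.hasFDerivAt_coord_real h0).congr_of_eventuallyEq ?_)
    · rw [h2]
      rfl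
    · have h3 : ∀ᶠ y in 𝓝 (z : Fin n → ℂ), V.coord y ∈ V.domain :=
        (V.analyticAt_coord h0).continuousAt.eventually_mem
          (V.isOpen_domain.mem_nhds (V.coord_mem_domain z.2 h0))
      filter_upwards [h3] with y hy
      exact V.quotCoord_param hy
  refine ⟨?_, fun z => ?_, fun z P hP u => ?_, fun z P hP v hv => ?_⟩
  · refine isManifold_of_contDiffOn _ _ _ ?_
    rintro _ _ ⟨V, rfl⟩ ⟨V', rfl⟩
    have h := V.contDiffOn_transition V'
    simp only [mfld_simps]
    exact h
  · obtain ⟨V, hz, h0⟩ := hchart z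
    exact ⟨_, hparam z V hz h0⟩
  · obtain ⟨V, hz, h0⟩ := hchart z
    obtain ⟨v, hv, h⟩ := V.exists_horizontal h0 u
    exact ⟨v, hv.1, by rw [hdiff z V hz h0 P hP v hv.1, h]⟩
  · obtain ⟨V, hz, h0⟩ := hchart z
    rw [hdiff z V hz h0 P hP v hv.1, hdiff z V hz h0 P hP _ hv.2, map_smul]

end ToricReduction

end
noncomputable section

namespace ToricReduction

/-! ### The operator `i ∂∂̄` on real functions -/

section Levi

variable {d d' : ℕ}

/-- The value of `i ∂∂̄f` on two vectors, in terms of the second derivative of `f`. -/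
def leviForm (f : (Fin d → ℂ) → ℝ) (y v v' : Fin d → ℂ) : ℝ :=
  (fderiv ℝ (fderiv ℝ f) y v' (Complex.I • v) - fderiv ℝ (fderiv ℝ f) y v (Complex.I • v')) / 2

theorem leviForm_congr {f g : (Fin d → ℂ) → ℝ} {y : Fin d → ℂ} (h : f =ᶠ[𝓝 y] g)
    (v v' : Fin d → ℂ) : leviForm f y v v' = leviForm g y v v' := by
  rw [leviForm, leviForm, (h.fderiv (𝕜 := ℝ)).fderiv_eq]

theorem dbar_apply (F : (Fin d → ℂ) → ℂ) (y : Fin d → ℂ) (v : Fin 1 → Fin d → ℂ) :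
    dbar F y v = (1 / 2 : ℂ) * (fderiv ℝ F y (v 0) +
      Complex.I * fderiv ℝ F y (Complex.I • v 0)) := rfl

theorem differentiableAt_dbar {F : (Fin d → ℂ) → ℂ} {y : Fin d → ℂ}
    (h : DifferentiableAt ℝ (fderiv ℝ F) y) : DifferentiableAt ℝ (dbar F) y := by
  have h1 : DifferentiableAt ℝ (fun z => (1 / 2 : ℂ) • (fderiv ℝ F z + Complex.I •
      (fderiv ℝ F z).comp ((Complex.I •
        ContinuousLinearMap.id ℂ (Fin d → ℂ)).restrictScalars ℝ))) y :=
    (h.add ((h.clm_comp (differentiableAt_const _)).const_smul Complex.I)).const_smul (1 / 2 : ℂ)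
  exact (ContinuousAlternatingMap.ofSubsingletonLIE (𝕜 := ℝ) (E := Fin d → ℂ) (F := ℂ)
    (0 : Fin 1)).toContinuousLinearEquiv.differentiableAt.comp y h1

/-- Antisymmetrizing the derivative of ∂̄f cancels the plain second derivatives by symmetry; the
terms carrying a factor i survive and become real. -/
theorem iddbar_apply {f : (Fin d → ℂ) → ℝ} {y : Fin d → ℂ} (hf : ContDiffAt ℝ 2 f y)
    (v v' : Fin d → ℂ) :
    iddbar (fun z => (f z : ℂ)) y ![v, v'] = ((leviForm f y v v' : ℝ) : ℂ) := by
  have hF : ContDiffAt ℝ 2 (fun z => (f z : ℂ)) y := Complex.ofRealCLM.contDiff.contDiffAt.comp y hf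
  have hF' : DifferentiableAt ℝ (fderiv ℝ fun z => (f z : ℂ)) y :=
    (hF.fderiv_right (m := 1) (by norm_num)).differentiableAt (by simp)
  have hf' : HasFDerivAt (fderiv ℝ f) (fderiv ℝ (fderiv ℝ f) y) y :=
    ((hf.fderiv_right (m := 1) (by norm_num)).differentiableAt (by simp)).hasFDerivAt
  have hnear : ∀ᶠ z in 𝓝 y, ∀ u, fderiv ℝ (fun z => (f z : ℂ)) z u = ((fderiv ℝ f z u : ℝ) : ℂ) := by
    filter_upwards [hf.eventually (by simp)] with z hz u
    have := Complex.ofRealCLM.hasFDerivAt.comp z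
      (hz.differentiableAt (by simp)).hasFDerivAt
    exact congrArg (fun L : (Fin d → ℂ) →L[ℝ] ℂ => L u) this.fderiv
  have key : ∀ u w : Fin d → ℂ, fderiv ℝ (fun z => dbar (fun z => (f z : ℂ)) z ![w]) y u =
      (1 / 2 : ℂ) * ((fderiv ℝ (fderiv ℝ f) y u w : ℝ) +
        Complex.I * (fderiv ℝ (fderiv ℝ f) y u (Complex.I • w) : ℝ)) := fun u w => by
    have h1 : ∀ w, HasFDerivAt (fun z => ((fderiv ℝ f z w : ℝ) : ℂ))
        (Complex.ofRealCLM.comp ((ContinuousLinearMap.apply ℝ ℝ w).comp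
          (fderiv ℝ (fderiv ℝ f) y))) y := fun w =>
      Complex.ofRealCLM.hasFDerivAt.comp y
        ((ContinuousLinearMap.apply ℝ ℝ w).hasFDerivAt.comp y hf')
    have h2 := ((h1 w).add ((h1 (Complex.I • w)).const_mul Complex.I)).const_mul (1 / 2 : ℂ)
    rw [(h2.congr_of_eventuallyEq ?_).fderiv]
    · rfl
    · filter_upwards [hnear] with z hz
      rw [dbar_apply]
      simp only [Matrix.cons_val_fin_one, hz]
      rfl
  have hsymm : ∀ u w, fderiv ℝ (fderiv ℝ f) y u w = fderiv ℝ (fderiv ℝ f) y w u :=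
    (hf.isSymmSndFDerivAt (by simp)).eq
  have e0 : (0 : Fin 2).removeNth ![v, v'] = ![v'] := by
    funext i; fin_cases i; rfl
  have e1 : (1 : Fin 2).removeNth ![v, v'] = ![v] := by
    funext i; fin_cases i; rfl
  have h3 : iddbar (fun z => (f z : ℂ)) y ![v, v'] = Complex.I *
      (extDeriv (dbar fun z => (f z : ℂ)) y ![v, v']) := rfl
  rw [h3, extDeriv_apply (differentiableAt_dbar hF'), Fin.sum_univ_two, e0, e1, key, key, leviForm]
  simp only [Matrix.cons_val_zero, Matrix.cons_val_one, hsymm v' v]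
  push_cast
  simp only [Fin.val_zero, Fin.val_one, pow_zero, pow_one, one_smul, neg_smul]
  linear_combination (1 / 2 : ℂ) * ((fderiv ℝ (fderiv ℝ f) y v (Complex.I • v') : ℝ) -
    (fderiv ℝ (fderiv ℝ f) y v' (Complex.I • v) : ℝ)) * Complex.I_mul_I

/-- The chain rule adds a term df(D²g). Here D²g is symmetric and commutes with i, so this term
cancels in the antisymmetrization. -/
theorem leviForm_comp {f : (Fin d' → ℂ) → ℝ} {g : (Fin d → ℂ) → (Fin d' → ℂ)} {y : Fin d → ℂ}
    (hf : ContDiffAt ℝ 2 f (g y)) (hg : ContDiffAt ℝ 2 g y)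
    (hhol : ∀ᶠ z in 𝓝 y, ∀ u, fderiv ℝ g z (Complex.I • u) = Complex.I • fderiv ℝ g z u)
    (v v' : Fin d → ℂ) :
    leviForm (f ∘ g) y v v' = leviForm f (g y) (fderiv ℝ g y v) (fderiv ℝ g y v') := by
  have hf' : HasFDerivAt (fderiv ℝ f) (fderiv ℝ (fderiv ℝ f) (g y)) (g y) :=
    ((hf.fderiv_right (m := 1) (by norm_num)).differentiableAt (by simp)).hasFDerivAt
  have hg' : HasFDerivAt (fderiv ℝ g) (fderiv ℝ (fderiv ℝ g) y) y :=
    ((hg.fderiv_right (m := 1) (by norm_num)).differentiableAt (by simp)).hasFDerivAt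
  have hg1 : HasFDerivAt g (fderiv ℝ g y) y := (hg.differentiableAt (by simp)).hasFDerivAt
  have hfg : fderiv ℝ (f ∘ g) =ᶠ[𝓝 y] fun z => (fderiv ℝ f (g z)).comp (fderiv ℝ g z) := by
    filter_upwards [hg.eventually (by simp),
      hg.continuousAt.eventually (hf.eventually (by simp))] with z hz1 hz2
    exact fderiv_comp z (hz2.differentiableAt (by simp)) (hz1.differentiableAt (by simp))
  have h1 := (hf'.comp y hg1).clm_comp hg'
  have h2 : ∀ u w, fderiv ℝ (fderiv ℝ (f ∘ g)) y u w =
      fderiv ℝ (fderiv ℝ f) (g y) (fderiv ℝ g y u) (fderiv ℝ g y w) +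
        fderiv ℝ f (g y) (fderiv ℝ (fderiv ℝ g) y u w) := fun u w => by
    rw [hfg.fderiv_eq]
    have h3 := h1.fderiv
    simp only [Function.comp_def] at h3
    rw [h3]
    simp [add_comm]
  have h4 : ∀ u w, fderiv ℝ (fderiv ℝ g) y u (Complex.I • w) =
      Complex.I • fderiv ℝ (fderiv ℝ g) y u w := fun u w => by
    have h5 : ∀ w, HasFDerivAt (fun z => fderiv ℝ g z w)
        ((ContinuousLinearMap.apply ℝ (Fin d' → ℂ) w).comp (fderiv ℝ (fderiv ℝ g) y)) y :=
      fun w => (ContinuousLinearMap.apply ℝ (Fin d' → ℂ) w).hasFDerivAt.comp y hg'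
    have h6 := ((h5 w).const_smul Complex.I).congr_of_eventuallyEq
      (f₁ := fun z => fderiv ℝ g z (Complex.I • w)) (by filter_upwards [hhol] with z hz using hz w)
    exact congrArg (fun L : (Fin d → ℂ) →L[ℝ] (Fin d' → ℂ) => L u) ((h5 (Complex.I • w)).unique h6)
  have hsymm : ∀ u w, fderiv ℝ (fderiv ℝ g) y u w = fderiv ℝ (fderiv ℝ g) y w u :=
    (hg.isSymmSndFDerivAt (by simp)).eq
  have hh := hhol.self_of_nhds
  rw [leviForm, leviForm, h2, h2, h4, h4, hsymm v' v, hh, hh]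
  ring

end Levi

end ToricReduction

end
noncomputable section

namespace ToricReduction

namespace Vertex

variable {n : ℕ} {G : Subgroup (Fin n → Circle)} {lam : lieAlg G →L[ℝ] ℝ} (V : Vertex G lam)

/-! ### The potential in toric coordinates -/

/-- The potential in toric coordinates, up to the choice of `b`. -/
def toricPotential (c : Fin n → ℝ) (w : Model G) : ℝ :=
  ∑ i, Real.exp (2 * V.sol w i) + ∑ j, Real.exp (2 * V.mon (V.sol w) j) * ‖w j‖ ^ 2
    - 2 * ∑ i, V.l i * V.sol w i - ∑ j, c (V.t j) * Real.log (‖w j‖ ^ 2)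

/-- Each log |z_l|² on the lift is linear in `sol` up to log |w_j|²; the equations satisfied by c
collect the linear parts into 2 ∑ l_i b_i. A zero w_j is harmless when its coefficient vanishes. -/
theorem potential_param {c : Fin n → ℝ} {w : Model G}
    (hc : ∀ i, c (V.s i) + ∑ j, (V.a i j : ℝ) * c (V.t j) = V.l i) (hw : w ∈ V.domain)
    (hcw : ∀ j, c (V.t j) = 0 ∨ w j ≠ 0) :
    potential G lam c (V.param w) = V.toricPotential c w := by
  have h1 : ∀ j, c (V.t j) * Real.log (‖w j‖ ^ 2 * Real.exp (2 * V.mon (V.sol w) j)) =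
      c (V.t j) * Real.log (‖w j‖ ^ 2) + 2 * (c (V.t j) * V.mon (V.sol w) j) := fun j => by
    rcases hcw j with h | h
    · simp [h]
    · rw [Real.log_mul (pow_ne_zero _ (norm_ne_zero_iff.2 h)) (Real.exp_pos _).ne', Real.log_exp]
      ring
  rw [param, potential_proj, V.point_coe hw, V.sum_eq]
  simp only [lift_s, lift_t, norm_mul, mul_pow, norm_exp_ofReal_sq, Real.log_exp, h1,
    Finset.sum_sub_distrib, Finset.sum_add_distrib, ← Finset.mul_sum, toricPotential]
  rw [V.sum_mul_mon]
  simp only [← hc, add_mul, Finset.sum_add_distrib]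
  have h2 : ∑ j, ‖w j‖ ^ 2 * Real.exp (2 * V.mon (V.sol w) j) =
      ∑ j, Real.exp (2 * V.mon (V.sol w) j) * ‖w j‖ ^ 2 :=
    Finset.sum_congr rfl fun j _ => mul_comm _ _
  have h3 : ∑ i, c (V.s i) * (2 * V.sol w i) = 2 * ∑ i, c (V.s i) * V.sol w i := by
    rw [Finset.mul_sum]
    exact Finset.sum_congr rfl fun i _ => by ring
  rw [h2, h3]
  ring

theorem contDiffAt_toricPotential {c : Fin n → ℝ} {w : Model G} (hw : w ∈ V.domain)
    (hcw : ∀ j, c (V.t j) = 0 ∨ w j ≠ 0) : ContDiffAt ℝ ∞ (V.toricPotential c) w := by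
  have h1 : ∀ i, ContDiffAt ℝ ∞ (fun y => V.sol y i) w := contDiffAt_pi.1 (V.contDiffAt_sol hw)
  have h2 : ∀ j, ContDiffAt ℝ ∞ (fun y => V.mon (V.sol y) j) w := fun j =>
    (contDiffAt_pi.1 V.contDiff_mon.contDiffAt j).comp w (V.contDiffAt_sol hw)
  have h3 : ∀ j, ContDiffAt ℝ ∞ (fun y : Model G => ‖y j‖ ^ 2) w := fun j =>
    ContDiffAt.norm_sq ℝ (by fun_prop)
  have h4 : ∀ j, ContDiffAt ℝ ∞ (fun y : Model G => c (V.t j) * Real.log (‖y j‖ ^ 2)) w :=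
    fun j => by
      rcases hcw j with h | h
      · simp only [h, zero_mul]
        exact contDiffAt_const
      · exact contDiffAt_const.mul ((h3 j).log (pow_ne_zero _ (norm_ne_zero_iff.2 h)))
  unfold toricPotential
  refine ContDiffAt.sub (ContDiffAt.sub (ContDiffAt.add ?_ ?_) ?_)
    (ContDiffAt.sum fun j _ => h4 j)
  · exact ContDiffAt.sum fun i _ => (contDiffAt_const.mul (h1 i)).exp
  · exact ContDiffAt.sum fun j _ => ((contDiffAt_const.mul (h2 j)).exp).mul (h3 j)
  · exact contDiffAt_const.mul (ContDiffAt.sum fun i _ => contDiffAt_const.mul (h1 i))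

theorem hasDerivAt_log_norm_sq {f : ℝ → ℂ} {f' : ℂ} {x : ℝ} (hf : HasDerivAt f f' x)
    (h0 : f x ≠ 0) : HasDerivAt (fun y => Real.log (‖f y‖ ^ 2)) (2 * (f' / f x).re) x := by
  have h1 : ‖f x‖ ^ 2 ≠ 0 := pow_ne_zero _ (norm_ne_zero_iff.2 h0)
  refine ((hasDerivAt_norm_sq hf).log h1).congr_deriv ?_
  have h2 : (starRingEnd ℂ) (f x) * f' = (Complex.normSq (f x) : ℂ) * (f' / f x) := by
    rw [← Complex.mul_conj]
    field_simp
  rw [div_eq_iff h1, h2, Complex.re_ofReal_mul, ← Complex.normSq_eq_norm_sq]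
  ring

theorem hasDerivAt_sol {w : Model G} (hw : w ∈ V.domain) (u : Model G) :
    HasDerivAt (fun x : ℝ => V.sol (w + x • u)) (fderiv ℝ V.sol w u) 0 :=
  ((V.contDiffAt_sol hw).differentiableAt (by simp)).hasFDerivAt.comp_hasDerivAt_of_eq
    (0 : ℝ) (hasDerivAt_line w u) (by simp)

/-- Envelope principle: at a critical point in b only the explicit dependence on w contributes. -/
theorem fderiv_toricPotential {c : Fin n → ℝ} {w : Model G} (hw : w ∈ V.domain)
    (hcw : ∀ j, c (V.t j) = 0 ∨ w j ≠ 0) (u : Model G) :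
    fderiv ℝ (V.toricPotential c) w u =
      ∑ j, (2 * Real.exp (2 * V.mon (V.sol w) j) * ((starRingEnd ℂ) (w j) * u j).re
        - c (V.t j) * (2 * (u j / w j).re)) := by
  have hl := hasDerivAt_line w u
  have h1 := ((V.contDiffAt_toricPotential hw hcw).differentiableAt
    (by simp)).hasFDerivAt.comp_hasDerivAt_of_eq (0 : ℝ) hl (by simp)
  have hs := V.hasDerivAt_sol hw u
  set β := fderiv ℝ V.sol w u
  have h4 : ∀ j, HasDerivAt (fun x : ℝ => c (V.t j) * Real.log (‖(w + x • u) j‖ ^ 2))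
      (c (V.t j) * (2 * (u j / w j).re)) 0 := fun j => by
    rcases hcw j with h | h
    · simp only [h, zero_mul]
      exact hasDerivAt_const _ _
    · have := (hasDerivAt_log_norm_sq (hasDerivAt_pi.1 hl j) (by simpa using h)).const_mul (c (V.t j))
      simpa using this
  have h5 := (((HasDerivAt.fun_sum (u := Finset.univ) fun i _ =>
    ((hasDerivAt_pi.1 hs i).const_mul 2).exp).add (HasDerivAt.fun_sum (u := Finset.univ) fun j _ =>
      (((V.hasDerivAt_mon hs j).const_mul 2).exp).mul (hasDerivAt_norm_sq (hasDerivAt_pi.1 hl j)))).sub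
    ((HasDerivAt.fun_sum (u := Finset.univ) fun i _ =>
      (hasDerivAt_pi.1 hs i).const_mul (V.l i)).const_mul 2)).sub
    (HasDerivAt.fun_sum (u := Finset.univ) fun j _ => h4 j)
  rw [h1.unique h5]
  simp only [zero_smul, add_zero]
  -- Criticality, paired with the variation of `sol`: exactly the combination that has to cancel.
  have h6 : ∑ i, V.eqn w (V.sol w) i * (2 * β i) = 0 := by simp [V.eqn_sol hw]
  have h7 := V.sum_mul_mon (fun j => Real.exp (2 * V.mon (V.sol w) j) * ‖w j‖ ^ 2)
    (fun i => 2 * β i)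
  have h8 : ∀ j, V.mon (fun i => 2 * β i) j = 2 * V.mon β j := fun j => by
    simp only [mon, Finset.mul_sum]
    exact Finset.sum_congr rfl fun i _ => by ring
  simp only [eqn, add_mul, sub_mul, Finset.sum_add_distrib, Finset.sum_sub_distrib, ← h7] at h6
  simp only [h8] at h6
  rw [Finset.sum_sub_distrib]
  simp only [Finset.sum_add_distrib]
  have e1 : ∑ i, Real.exp (2 * V.sol w i) * (2 * β i) = ∑ i, V.l i * (2 * β i)
      - ∑ j, Real.exp (2 * V.mon (V.sol w) j) * ‖w j‖ ^ 2 * (2 * V.mon β j) := by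
    linarith
  have e2 : ∑ i, V.l i * (2 * β i) = 2 * ∑ i, V.l i * β i := by
    rw [Finset.mul_sum]
    exact Finset.sum_congr rfl fun i _ => by ring
  have e3 : ∑ j, Real.exp (2 * V.mon (V.sol w) j) * (2 * V.mon β j) * ‖w j‖ ^ 2 =
      ∑ j, Real.exp (2 * V.mon (V.sol w) j) * ‖w j‖ ^ 2 * (2 * V.mon β j) :=
    Finset.sum_congr rfl fun j _ => by ring
  have e4 : ∑ j, Real.exp (2 * V.mon (V.sol w) j) * (2 * ((starRingEnd ℂ) (w j) * u j).re) =
      ∑ j, 2 * Real.exp (2 * V.mon (V.sol w) j) * ((starRingEnd ℂ) (w j) * u j).re :=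
    Finset.sum_congr rfl fun j _ => by ring
  rw [e1, e2, e3, e4]
  ring

theorem eventually_ne_or {c : Fin n → ℝ} {w : Model G} (hcw : ∀ j, c (V.t j) = 0 ∨ w j ≠ 0) :
    ∀ᶠ y in 𝓝 w, ∀ j, c (V.t j) = 0 ∨ y j ≠ 0 := by
  refine Filter.eventually_all.2 fun j => ?_
  rcases hcw j with h | h
  · exact Filter.Eventually.of_forall fun _ => Or.inl h
  · filter_upwards [(continuous_apply j).continuousAt.eventually_ne h] with y hy using Or.inr hy

theorem fderiv_fderiv_toricPotential {c : Fin n → ℝ} {w : Model G} (hw : w ∈ V.domain)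
    (hcw : ∀ j, c (V.t j) = 0 ∨ w j ≠ 0) (u u' : Model G) :
    fderiv ℝ (fderiv ℝ (V.toricPotential c)) w u u' =
      ∑ j, (4 * Real.exp (2 * V.mon (V.sol w) j) * V.mon (fderiv ℝ V.sol w u) j *
          ((starRingEnd ℂ) (w j) * u' j).re
        + 2 * Real.exp (2 * V.mon (V.sol w) j) * ((starRingEnd ℂ) (u j) * u' j).re
        + c (V.t j) * (2 * (u' j * u j / w j ^ 2).re)) := by
  have hl := hasDerivAt_line w u
  have hl0 : w = w + (0 : ℝ) • u := by simp
  have hs := V.hasDerivAt_sol hw u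
  have hd : HasFDerivAt (fderiv ℝ (V.toricPotential c))
      (fderiv ℝ (fderiv ℝ (V.toricPotential c)) w) w :=
    ((((V.contDiffAt_toricPotential hw hcw).of_le (m := 2) ENat.LEInfty.out).fderiv_right
      (m := 1) (by norm_num)).differentiableAt (by simp)).hasFDerivAt
  have h1 := hd.comp_hasDerivAt_of_eq (0 : ℝ) hl hl0
  have h2 := (ContinuousLinearMap.apply ℝ ℝ u').hasFDerivAt.comp_hasDerivAt (0 : ℝ) h1
  have h3 : (fun x : ℝ => ∑ j, (2 * Real.exp (2 * V.mon (V.sol (w + x • u)) j) *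
      ((starRingEnd ℂ) ((w + x • u) j) * u' j).re - c (V.t j) * (2 * (u' j / (w + x • u) j).re)))
      =ᶠ[𝓝 0] ((ContinuousLinearMap.apply ℝ ℝ u') ∘ fderiv ℝ (V.toricPotential c) ∘
        fun x : ℝ => w + x • u) := by
    have hc := hl.continuousAt
    rw [ContinuousAt, ← hl0] at hc
    filter_upwards [hc.eventually (V.isOpen_domain.mem_nhds hw),
      hc.eventually (V.eventually_ne_or hcw)] with x hx1 hx2
    exact (V.fderiv_toricPotential hx1 hx2 u').symm
  have hre : ∀ {f : ℝ → ℂ} {f' : ℂ}, HasDerivAt f f' 0 →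
      HasDerivAt (fun x => (f x).re) f'.re 0 := fun h =>
    Complex.reCLM.hasFDerivAt.comp_hasDerivAt (0 : ℝ) h
  have hconj : ∀ {f : ℝ → ℂ} {f' : ℂ}, HasDerivAt f f' 0 →
      HasDerivAt (fun x => (starRingEnd ℂ) (f x)) ((starRingEnd ℂ) f') 0 := fun h =>
    Complex.conjCLE.toContinuousLinearMap.hasFDerivAt.comp_hasDerivAt (0 : ℝ) h
  -- Where w_j may vanish, the coefficient is zero and the junk value of the division is irrelevant.
  have h4 : ∀ j, HasDerivAt (fun x : ℝ => c (V.t j) * (2 * (u' j / (w + x • u) j).re))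
      (-(c (V.t j) * (2 * (u' j * u j / w j ^ 2).re))) 0 := fun j => by
    rcases hcw j with h | h
    · simp only [h, zero_mul, neg_zero]
      exact hasDerivAt_const _ _
    · have := ((hre ((hasDerivAt_const (0 : ℝ) (u' j)).div (hasDerivAt_pi.1 hl j)
        (by simpa using h))).const_mul 2).const_mul (c (V.t j))
      refine this.congr_deriv ?_
      simp [neg_div]
  have h5 := (HasDerivAt.fun_sum (u := Finset.univ) fun j _ =>
    (((((V.hasDerivAt_mon hs j).const_mul 2).exp).const_mul 2).mul
      (hre ((hconj (hasDerivAt_pi.1 hl j)).mul_const (u' j)))).sub (h4 j))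
  refine (h2.congr_of_eventuallyEq h3).unique h5 |>.trans (Finset.sum_congr rfl fun j _ => ?_)
  simp only [zero_smul, add_zero]
  ring

theorem dlift_s {w : Model G} (hw : w ∈ V.domain) (u : Model G) (i) :
    V.dlift w u (V.s i) = ((Real.exp (V.sol w i) * fderiv ℝ V.sol w u i : ℝ) : ℂ) := by
  have h1 := hasDerivAt_pi.1 ((V.hasFDerivAt_lift hw).comp_hasDerivAt_of_eq (0 : ℝ)
    (hasDerivAt_line w u) (by simp)) (V.s i)
  have h2 := (hasDerivAt_pi.1 (V.hasDerivAt_sol hw u) i).exp.ofReal_comp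
  refine (h1.unique (h2.congr_of_eventuallyEq (Filter.Eventually.of_forall fun x => ?_))).trans ?_
  · simp only [Function.comp_apply, lift_s]
  · simp

theorem dlift_t {w : Model G} (hw : w ∈ V.domain) (u : Model G) (j) :
    V.dlift w u (V.t j) = (Real.exp (V.mon (V.sol w) j) : ℂ) *
      (u j + w j * (V.mon (fderiv ℝ V.sol w u) j : ℝ)) := by
  have h1 := hasDerivAt_pi.1 ((V.hasFDerivAt_lift hw).comp_hasDerivAt_of_eq (0 : ℝ)
    (hasDerivAt_line w u) (by simp)) (V.t j)
  have h2 := (hasDerivAt_pi.1 (hasDerivAt_line w u) j).mul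
    (V.hasDerivAt_mon (V.hasDerivAt_sol hw u) j).exp.ofReal_comp
  refine (h1.unique (h2.congr_of_eventuallyEq (Filter.Eventually.of_forall fun x => ?_))).trans ?_
  · simp only [Function.comp_apply, lift_t, Pi.mul_apply]
  · simp
    ring

/-- On the `V.s` coordinates the lifted vectors are real and contribute nothing to the standard
form; the remaining terms match one j at a time. -/
theorem leviForm_toricPotential {c : Fin n → ℝ} {w : Model G} (hw : w ∈ V.domain)
    (hcw : ∀ j, c (V.t j) = 0 ∨ w j ≠ 0) (u u' : Model G) :
    leviForm (V.toricPotential c) w u u' = stdForm (V.dlift w u) (V.dlift w u') := by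
  rw [leviForm, V.fderiv_fderiv_toricPotential hw hcw, V.fderiv_fderiv_toricPotential hw hcw,
    stdForm, V.sum_eq, ← Finset.sum_sub_distrib, Finset.sum_div]
  have h1 : ∑ i, ((starRingEnd ℂ) (V.dlift w u (V.s i)) * V.dlift w u' (V.s i)).im = 0 :=
    Finset.sum_eq_zero fun i _ => by
      rw [V.dlift_s hw, V.dlift_s hw, Complex.conj_ofReal, ← Complex.ofReal_mul, Complex.ofReal_im]
  rw [h1, zero_add, Finset.mul_sum]
  refine Finset.sum_congr rfl fun j _ => ?_
  -- Pluriharmonicity of log |w_j|²: its Hessian is the real part of a symmetric complex bilinear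
  -- form, so it cancels.
  have h2 : (u' j * (Complex.I • u) j / w j ^ 2) = ((Complex.I • u') j * u j / w j ^ 2) := by
    simp only [Pi.smul_apply, smul_eq_mul]
    ring
  have hexp : Real.exp (2 * V.mon (V.sol w) j) = Real.exp (V.mon (V.sol w) j) ^ 2 := by
    rw [← Real.exp_nat_mul]; norm_num
  rw [V.dlift_t hw, V.dlift_t hw, hexp,
    show (Complex.I • u) j * u' j / w j ^ 2 = (Complex.I • u') j * u j / w j ^ 2 by
      rw [← h2, mul_comm]]
  simp only [Pi.smul_apply, smul_eq_mul, map_mul, map_add, Complex.conj_ofReal, Complex.mul_re,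
    Complex.mul_im, Complex.add_re, Complex.add_im, Complex.conj_re, Complex.conj_im,
    Complex.ofReal_re, Complex.ofReal_im, Complex.I_re, Complex.I_im]
  ring

end Vertex

end ToricReduction

end
noncomputable section

namespace ToricReduction

variable {n : ℕ} {G : Subgroup (Fin n → Circle)} {lam : lieAlg G →L[ℝ] ℝ}

namespace Vertex

variable (V : Vertex G lam)

section Potential

variable {z : level G lam} {c : Fin n → ℝ}

theorem pairing_coeff (hc : ∀ ξ : lieAlg G, ∑ l, c l * (ξ : Fin n → ℝ) l = lam ξ) :
    ∀ i, c (V.s i) + ∑ j, (V.a i j : ℝ) * c (V.t j) = V.l i := by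
  rw [← V.pairing_iff c V.l]
  intro ξ hξ
  rw [hc ⟨ξ, hξ⟩, V.lam_apply]

theorem coord_ne_zero (h0 : ∀ i, (z : Fin n → ℂ) (V.s i) ≠ 0)
    (hcz : ∀ l, c l = 0 ∨ (z : Fin n → ℂ) l ≠ 0) (j) : c (V.t j) = 0 ∨ V.coord z j ≠ 0 :=
  (hcz (V.t j)).imp_right fun h => mul_ne_zero h
    (Finset.prod_ne_zero_iff.2 fun i _ => zpow_ne_zero _ (h0 i))

theorem potential_param_eventuallyEq
    (hc : ∀ ξ : lieAlg G, ∑ l, c l * (ξ : Fin n → ℝ) l = lam ξ)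
    (h0 : ∀ i, (z : Fin n → ℂ) (V.s i) ≠ 0) (hcz : ∀ l, c l = 0 ∨ (z : Fin n → ℂ) l ≠ 0) :
    potential G lam c ∘ V.param =ᶠ[𝓝 (V.coord z)] V.toricPotential c := by
  filter_upwards [V.isOpen_domain.mem_nhds (V.coord_mem_domain z.2 h0),
    V.eventually_ne_or (V.coord_ne_zero h0 hcz)] with y hy1 hy2
  exact V.potential_param (V.pairing_coeff hc) hy1 hy2

end Potential

/-- The vertex, as a point of `ℝⁿ`. -/
def pt : Fin n → ℝ := V.glue V.l fun _ => 0

theorem pt_pairing (ξ : lieAlg G) : ∑ l, V.pt l * (ξ : Fin n → ℝ) l = lam ξ := by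
  rw [V.sum_eq, V.lam_apply]
  simp [pt]

theorem pt_eq_zero_or {z : Fin n → ℂ} (h0 : ∀ i, z (V.s i) ≠ 0) (l : Fin n) :
    V.pt l = 0 ∨ z l ≠ 0 := by
  obtain ⟨i | j, rfl⟩ := V.e.surjective l
  · exact Or.inr (h0 i)
  · exact Or.inl (by simp [pt])

/-! ### Arbitrary reduced complex structures -/

variable [cs : ChartedSpace (Model G) (ReducedSpace G lam)]

/-- Locally `param` is a smooth extension of the projection composed with `lift`. -/
theorem contMDiffAt_param (hcs : IsReducedComplexStructure G lam) {w : Model G}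
    (hw : w ∈ V.domain) : ContMDiffAt 𝓘(ℝ, Model G) 𝓘(ℝ, Model G) ∞ V.param w := by
  obtain ⟨P, hP⟩ := hcs.smooth ⟨V.lift w, V.lift_mem_level hw⟩
  refine (ContMDiffAt.comp w hP.1 (V.contDiffAt_lift hw).contMDiffAt).congr_of_eventuallyEq ?_
  filter_upwards [(V.contDiffAt_lift hw).continuousAt.eventually hP.eventually_eq_proj,
    V.isOpen_domain.mem_nhds hw] with y hy1 hy2
  rw [Function.comp_apply, hy1 (V.lift_mem_level hy2), param]
  congr 1
  exact Subtype.ext (V.point_coe hy2)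

theorem contDiffAt_chart_param (hcs : IsReducedComplexStructure G lam) {w : Model G}
    (hw : w ∈ V.domain) :
    ContDiffAt ℝ ∞ (fun y => chartAt (Model G) (V.param w) (V.param y)) w := by
  have := (contMDiffAt_iff.1 (V.contMDiffAt_param hcs hw)).2
  simp only [mfld_simps, contDiffWithinAt_univ] at this
  exact this

/-- The differential of the toric parametrization, in the chart at its value. -/
def dparam (w : Model G) : Model G →L[ℝ] Model G :=
  fderiv ℝ (fun y => chartAt (Model G) (V.param w) (V.param y)) w

theorem hasFDerivAt_dparam (hcs : IsReducedComplexStructure G lam) {w : Model G}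
    (hw : w ∈ V.domain) : HasFDerivAt (fun y => chartAt (Model G) (V.param w) (V.param y))
      (V.dparam w) w :=
  ((V.contDiffAt_chart_param hcs hw).differentiableAt (by simp)).hasFDerivAt

theorem differential_eq_dparam (hcs : IsReducedComplexStructure G lam) {z : level G lam}
    (h0 : ∀ i, (z : Fin n → ℂ) (V.s i) ≠ 0) {P : (Fin n → ℂ) → ReducedSpace G lam}
    (hP : IsLocalExtension G lam z P) {v : Fin n → ℂ} (hv : v ∈ levelTangent G (z : Fin n → ℂ)) :
    differential P z v = V.dparam (V.coord z) (V.dcoord z v) := by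
  have hw := V.coord_mem_domain z.2 h0
  have hP' := V.isLocalExtension_param_coord h0 (V.contMDiffAt_param hcs hw)
  rw [V.differential_eq h0 hP hP' hv]
  have h1 := (V.hasFDerivAt_dparam hcs hw).comp (z : Fin n → ℂ) (V.hasFDerivAt_coord_real h0)
  rw [V.param_coord h0] at h1
  rw [hP'.hasFDerivAt.unique h1]
  rfl

theorem exists_at_param (hcs : IsReducedComplexStructure G lam) {w : Model G}
    (hw : w ∈ V.domain) : ∃ P, IsLocalExtension G lam ⟨V.lift w, V.lift_mem_level hw⟩ P ∧
      ∀ v ∈ levelTangent G (V.lift w),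
        differential P (V.lift w) v = V.dparam w (V.dcoord (V.lift w) v) := by
  obtain ⟨P, hP⟩ := hcs.smooth ⟨V.lift w, V.lift_mem_level hw⟩
  refine ⟨P, hP, fun v hv => ?_⟩
  have := V.differential_eq_dparam hcs (V.lift_s_ne_zero w) hP hv
  rwa [V.coord_lift] at this

/-- Represent u by a horizontal vector: there both `dcoord` and the differential of the projection
commute with i. -/
theorem dparam_I_smul (hcs : IsReducedComplexStructure G lam) {w : Model G}
    (hw : w ∈ V.domain) (u : Model G) :
    V.dparam w (Complex.I • u) = Complex.I • V.dparam w u := by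
  obtain ⟨P, hP, h⟩ := V.exists_at_param hcs hw
  obtain ⟨v, hv, rfl⟩ := V.exists_horizontal (V.lift_s_ne_zero w) u
  rw [← map_smul, ← h v hv.1, ← h _ hv.2]
  exact hcs.complexLinear _ P hP v hv

theorem dparam_surjective (hcs : IsReducedComplexStructure G lam) {w : Model G}
    (hw : w ∈ V.domain) : Function.Surjective (V.dparam w) := fun u => by
  obtain ⟨P, hP, h⟩ := V.exists_at_param hcs hw
  obtain ⟨v, hv, rfl⟩ := hcs.submersion _ P hP u
  exact ⟨_, (h v hv).symm⟩

theorem mdifferentiableAt_param (hcs : IsReducedComplexStructure G lam) {w : Model G}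
    (hw : w ∈ V.domain) : MDifferentiableAt 𝓘(ℂ, Model G) 𝓘(ℂ, Model G) V.param w := by
  rw [mdifferentiableAt_iff]
  refine ⟨V.continuousAt_param hw, ?_⟩
  let L : Model G →L[ℂ] Model G :=
    LinearMap.toContinuousLinearMap
      { toFun := V.dparam w
        map_add' := map_add _
        map_smul' := fun a u => by
          have h1 : a • u = a.re • u + a.im • (Complex.I • u) := by
            funext j
            simp only [Pi.smul_apply, Pi.add_apply, smul_eq_mul, Complex.real_smul]
            conv_lhs => rw [← Complex.re_add_im a]
            ring
          have h2 : a • V.dparam w u =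
              a.re • V.dparam w u + a.im • (Complex.I • V.dparam w u) := by
            funext j
            simp only [Pi.smul_apply, Pi.add_apply, smul_eq_mul, Complex.real_smul]
            conv_lhs => rw [← Complex.re_add_im a]
            ring
          rw [h1, map_add, map_smul, map_smul, V.dparam_I_smul hcs hw, RingHom.id_apply, h2] }
  have h1 : HasFDerivAt (fun y => chartAt (Model G) (V.param w) (V.param y)) L w :=
    hasFDerivAt_of_restrictScalars ℝ (V.hasFDerivAt_dparam hcs hw) (by ext; rfl)
  simp only [writtenInExtChartAt, extChartAt, mfld_simps]
  exact h1.differentiableAt.differentiableWithinAt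

/-- At nearby y the fixed chart at `param w` need not be the preferred one, so complex linearity
uses the holomorphic compatibility of the atlas. -/
theorem eventually_complexLinear (hcs : IsReducedComplexStructure G lam) {w : Model G}
    (hw : w ∈ V.domain) : ∀ᶠ y in 𝓝 w, ∀ u,
      fderiv ℝ (fun y => chartAt (Model G) (V.param w) (V.param y)) y (Complex.I • u) =
        Complex.I • fderiv ℝ (fun y => chartAt (Model G) (V.param w) (V.param y)) y u := by
  have := hcs.isManifold
  have : IsManifold 𝓘(ℂ, Model G) 1 (ReducedSpace G lam) :=
    IsManifold.of_le (n := ω) le_top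
  filter_upwards [V.isOpen_domain.mem_nhds hw, (V.continuousAt_param hw).eventually
    ((chartAt (Model G) (V.param w)).open_source.mem_nhds (mem_chart_source _ _))] with y hy1 hy2 u
  have h1 : DifferentiableAt ℂ (fun y => chartAt (Model G) (V.param w) (V.param y)) y :=
    ((mdifferentiableAt_atlas (I := 𝓘(ℂ, Model G)) (chart_mem_atlas _ _) hy2).comp y
      (V.mdifferentiableAt_param hcs hy1)).differentiableAt
  rw [h1.fderiv_restrictScalars ℝ]
  exact (fderiv ℂ _ y).map_smul Complex.I u

/-- The differential of the toric parametrization as an isomorphism. -/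
def dparamEquiv (hcs : IsReducedComplexStructure G lam) {w : Model G} (hw : w ∈ V.domain) :
    Model G ≃L[ℝ] Model G :=
  (LinearEquiv.ofBijective (V.dparam w).toLinearMap
    ⟨LinearMap.injective_iff_surjective.2 (V.dparam_surjective hcs hw),
      V.dparam_surjective hcs hw⟩).toContinuousLinearEquiv

/-- By the inverse function theorem, `param` read in the chart has a smooth local inverse, which
transports smoothness from toric coordinates. -/
theorem contDiffAt_potential_chart_symm (hcs : IsReducedComplexStructure G lam) {w : Model G}
    (hw : w ∈ V.domain) {f : ReducedSpace G lam → ℝ} (hf : ContDiffAt ℝ ∞ (f ∘ V.param) w) :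
    ContDiffAt ℝ ∞ (fun y => f ((chartAt (Model G) (V.param w)).symm y))
      (chartAt (Model G) (V.param w) (V.param w)) := by
  set κ := chartAt (Model G) (V.param w)
  have h1 : HasFDerivAt (fun y => κ (V.param y))
      (V.dparamEquiv hcs hw : Model G →L[ℝ] Model G) w := V.hasFDerivAt_dparam hcs hw
  have h2 := V.contDiffAt_chart_param hcs hw
  have h3 := h2.to_localInverse h1 (by simp)
  have h4 := h2.localInverse_apply_image h1 (by simp)
  have h5 := (h2.hasStrictFDerivAt' h1 (by simp)).eventually_right_inverse
  rw [← h4] at hf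
  refine (hf.comp (κ (V.param w)) h3).congr_of_eventuallyEq ?_
  have h6 := h3.continuousAt
  rw [ContinuousAt, h4] at h6
  filter_upwards [h5, h6.eventually ((V.continuousAt_param hw).eventually
    (κ.open_source.mem_nhds (mem_chart_source _ _)))] with y hy1 hy2
  have h7 : κ (V.param (h2.localInverse h1 (by simp) y)) = y := hy1
  rw [Function.comp_apply, Function.comp_apply, ← κ.left_inv hy2, h7]

section Potential

variable {z : level G lam} {c : Fin n → ℝ}

theorem contDiffAt_potential (hcs : IsReducedComplexStructure G lam)
    (hc : ∀ ξ : lieAlg G, ∑ l, c l * (ξ : Fin n → ℝ) l = lam ξ)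
    (h0 : ∀ i, (z : Fin n → ℂ) (V.s i) ≠ 0) (hcz : ∀ l, c l = 0 ∨ (z : Fin n → ℂ) l ≠ 0) :
    ContDiffAt ℝ ∞ (fun y => potential G lam c ((chartAt (Model G) (proj G lam z)).symm y))
      (chartAt (Model G) (proj G lam z) (proj G lam z)) := by
  have hw := V.coord_mem_domain z.2 h0
  have h1 := V.contDiffAt_potential_chart_symm hcs hw
    ((V.contDiffAt_toricPotential hw (V.coord_ne_zero h0 hcz)).congr_of_eventuallyEq
      (V.potential_param_eventuallyEq hc h0 hcz))
  rwa [V.param_coord h0] at h1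

/-- Pull the Levi form back along the holomorphic `param` and compute in toric coordinates. Only the
affine equations for c matter, and c_l = 0 allows z_l = 0. -/
theorem manifoldIddbar_potential_eq_leviForm (hcs : IsReducedComplexStructure G lam)
    (hc : ∀ ξ : lieAlg G, ∑ l, c l * (ξ : Fin n → ℝ) l = lam ξ)
    (h0 : ∀ i, (z : Fin n → ℂ) (V.s i) ≠ 0) (hcz : ∀ l, c l = 0 ∨ (z : Fin n → ℂ) l ≠ 0)
    {P : (Fin n → ℂ) → ReducedSpace G lam} (hP : IsLocalExtension G lam z P) {v v' : Fin n → ℂ}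
    (hv : v ∈ levelTangent G (z : Fin n → ℂ)) (hv' : v' ∈ levelTangent G (z : Fin n → ℂ)) :
    manifoldIddbar (potential G lam c) (proj G lam z) (differential P z v) (differential P z v') =
      ((stdForm v v' : ℝ) : ℂ) := by
  have hw := V.coord_mem_domain z.2 h0
  have hsm := V.contDiffAt_potential hcs hc h0 hcz
  refine (iddbar_apply (hsm.of_le ENat.LEInfty.out) _ _).trans ?_
  rw [V.differential_eq_dparam hcs h0 hP hv,
    V.differential_eq_dparam hcs h0 hP hv', V.stdForm_eq_stdForm_dlift z.2 h0 hv hv',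
    ← V.leviForm_toricPotential hw (V.coord_ne_zero h0 hcz)]
  congr 1
  have h1 := V.contDiffAt_chart_param hcs hw
  have h2 := V.eventually_complexLinear hcs hw
  have h3 := (V.continuousAt_param hw).eventually
    ((chartAt (Model G) (V.param (V.coord z))).open_source.mem_nhds (mem_chart_source _ _))
  unfold dparam
  rw [V.param_coord h0] at h1 h2 h3 ⊢
  rw [← V.param_coord h0] at hsm
  have h4 := leviForm_comp (g := fun y => chartAt (Model G) (proj G lam z) (V.param y))
    (y := V.coord z)
    (f := fun y => potential G lam c ((chartAt (Model G) (proj G lam z)).symm y))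
    (by rw [V.param_coord h0] at hsm ⊢; exact hsm.of_le ENat.LEInfty.out)
    (h1.of_le ENat.LEInfty.out) h2 (V.dcoord z v) (V.dcoord z v')
  rw [V.param_coord h0] at h4
  rw [← h4]
  refine leviForm_congr (Filter.EventuallyEq.trans ?_ (V.potential_param_eventuallyEq hc h0 hcz)) _ _
  filter_upwards [h3] with y hy
  rw [Function.comp_apply, Function.comp_apply, (chartAt (Model G) (proj G lam z)).left_inv hy]

end Potential

end Vertex

/-! ### Existence and uniqueness of the reduced form -/

section ReducedForm

variable [cs : ChartedSpace (Model G) (ReducedSpace G lam)]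

/-- The real part of `i ∂∂̄f`, as a field of 2-forms. -/
def reManifoldIddbar (f : ReducedSpace G lam → ℝ) (x : ReducedSpace G lam) :
    (TangentSpace 𝓘(ℝ, Model G) x) [⋀^Fin 2]→L[ℝ] ℝ :=
  Complex.reCLM.compContinuousAlternatingMap
    (iddbar (fun y : Model G => ((f ((chartAt (Model G) x).symm y) : ℝ) : ℂ))
      (chartAt (Model G) x x))

theorem exists_isReducedForm (hV : ∀ z ∈ level G lam, ∃ V : Vertex G lam, ∀ i, z (V.s i) ≠ 0)
    (hcs : IsReducedComplexStructure G lam) : ∃ σ : TwoForm G lam, IsReducedForm σ := by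
  have hV' : ∀ x : ReducedSpace G lam, ∃ V : Vertex G lam, x ∈ V.source := fun x => by
    obtain ⟨z, rfl⟩ := proj_surjective x
    obtain ⟨V, h⟩ := hV z z.2
    exact ⟨V, (V.proj_mem_source_iff z).2 h⟩
  choose V hVx using hV'
  -- With c the vertex, the potential is smooth on the whole chart, including points outside `U`.
  -- The vertex may vary with x, since the defining property is pointwise.
  refine ⟨fun x => reManifoldIddbar (potential G lam (V x).pt) x, fun z P hP v hv v' hv' => ?_⟩
  have h0 := ((V (proj G lam z)).proj_mem_source_iff z).1 (hVx _)
  have h1 := (V (proj G lam z)).manifoldIddbar_potential_eq_leviForm hcs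
    (V (proj G lam z)).pt_pairing h0 ((V (proj G lam z)).pt_eq_zero_or h0) hP hv hv'
  have h2 : ∀ x, x = proj G lam z → reManifoldIddbar (potential G lam (V x).pt) x
      ![differential P z v, differential P z v'] = stdForm v v' := by
    rintro _ rfl
    exact (congrArg Complex.re h1).trans (Complex.ofReal_re _)
  exact h2 _ hP.apply_self

theorem exists_tangent_lifts (hcs : IsReducedComplexStructure G lam) (z : level G lam) :
    ∃ P, IsLocalExtension G lam z P ∧ ∀ u : Model G,
      ∃ v ∈ levelTangent G (z : Fin n → ℂ), differential P z v = u := by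
  obtain ⟨P, hP⟩ := hcs.smooth z
  exact ⟨P, hP, hcs.submersion z P hP⟩

/-- As the projection is a submersion, every pair of tangent vectors lifts, and the values on lifts
are prescribed. -/
theorem IsReducedForm.eq (hcs : IsReducedComplexStructure G lam) {σ τ : TwoForm G lam}
    (hσ : IsReducedForm σ) (hτ : IsReducedForm τ) : σ = τ := by
  funext x
  obtain ⟨z, rfl⟩ := proj_surjective x
  obtain ⟨P, hP, hlift⟩ := exists_tangent_lifts hcs z
  rw [← hP.apply_self]
  ext u
  obtain ⟨v, hv, hu⟩ := hlift (u 0)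
  obtain ⟨v', hv', hu'⟩ := hlift (u 1)
  have h : u = ![differential P z v, differential P z v'] := by
    funext i
    fin_cases i
    exacts [hu.symm, hu'.symm]
  rw [h]
  exact (hσ z P hP v hv v' hv').trans (hτ z P hP v hv v' hv').symm

end ReducedForm

end ToricReduction

end

/-! ### The reduction theorem -/

open ToricReduction in
theorem theorem12p1 {n : ℕ} (G : Subgroup (Fin n → Circle)) (hG : IsSubtorus G)
    (hpol : Polarized G) (lam : lieAlg G →L[ℝ] ℝ) (hreg : IsRegularValue G lam)
    (hfree : ActsFreely G lam) (c : Fin n → ℝ) (hc : c ∈ momentPolytope G lam) :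
    -- the reduced complex structure exists
    (∃ cs : ChartedSpace (Model G) (ReducedSpace G lam), IsReducedComplexStructure G lam) ∧
    -- `U` is open and dense
    IsOpen (openPart G lam) ∧ Dense (openPart G lam) ∧
    ∀ cs : ChartedSpace (Model G) (ReducedSpace G lam), IsReducedComplexStructure G lam →
      -- the reduced form exists and is unique
      (∃! σ : TwoForm G lam, IsReducedForm σ) ∧
      -- the potential is smooth on `U`
      ContMDiffOn 𝓘(ℝ, Model G) 𝓘(ℝ, ℝ) ∞ (potential G lam c) (openPart G lam) ∧
      -- the reduced form is `i ∂∂̄` of the potential on `U`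
      ∀ σ : TwoForm G lam, IsReducedForm σ → ∀ x ∈ openPart G lam,
        ∀ u v : TangentSpace 𝓘(ℝ, Model G) x,
          ((σ x ![u, v] : ℝ) : ℂ) = manifoldIddbar (potential G lam c) x u v := by
  have hV : ∀ z ∈ level G lam, ∃ V : Vertex G lam, ∀ i, z (V.s i) ≠ 0 :=
    fun z hz => exists_vertex hpol hreg hfree hz
  have hc' : ∀ ξ : lieAlg G, ∑ l, c l * (ξ : Fin n → ℝ) l = lam ξ := by
    obtain ⟨x, rfl⟩ := hc
    obtain ⟨z, rfl⟩ := proj_surjective x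
    exact mem_level_iff.1 z.2
  refine ⟨⟨toricChartedSpace hV, isReducedComplexStructure_toric hV⟩, isOpen_openPart,
    dense_openPart hV, fun cs hcs => ⟨?_, ?_, ?_⟩⟩
  · obtain ⟨σ, hσ⟩ := exists_isReducedForm hV hcs
    exact ⟨σ, hσ, fun τ hτ => hτ.eq hcs hσ⟩
  · rintro _ ⟨z, hz, rfl⟩
    obtain ⟨V, h0⟩ := hV z z.2
    have h1 := V.contDiffAt_potential hcs hc' h0 fun l => Or.inr (hz l)
    set κ := chartAt (Model G) (proj G lam z)
    refine ContMDiffAt.contMDiffWithinAt (contMDiffAt_iff.2 ⟨?_, ?_⟩)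
    · refine (h1.continuousAt.comp (κ.continuousAt (mem_chart_source _ _))).congr ?_
      filter_upwards [κ.open_source.mem_nhds (mem_chart_source _ _)] with y hy
      rw [Function.comp_apply, κ.left_inv hy]
    · simp only [mfld_simps, contDiffWithinAt_univ]
      exact h1
  · rintro σ hσ _ ⟨z, hz, rfl⟩ u v
    obtain ⟨V, h0⟩ := hV z z.2
    obtain ⟨P, hP, hlift⟩ := exists_tangent_lifts hcs z
    obtain ⟨u', hu', rfl⟩ := hlift u
    obtain ⟨v', hv', rfl⟩ := hlift v
    rw [V.manifoldIddbar_potential_eq_leviForm hcs hc' h0 (fun l => Or.inr (hz l)) hP hu' hv',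
      ← hσ z P hP u' hu' v' hv', hP.apply_self]
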